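/- **Shape gradient of the piecewise constant Mumford–Shah energy.** Let $D\subseteq\mathbb R^2$ be a closed set of finite area, and let $\Omega\subset D$ be the bounded open region enclosed by a simple closed regular $C^2$ curve $\Gamma=\partial\Omega$, with $|D\setminus\Omega|>0$. Write $\Omega^c=D\setminus\Omega$, let $n$ be the outward unit normal of $\Omega$ on $\Gamma$, and let $H$ be the curvature of $\Gamma$ (signed so that $H=1/R$ if $\Omega$ is a disc of radius $R$). Let $f\in L^2(D)$ be a function that is continuous (relative to $D$) at every point of $\Gamma$, and let $\eta\in\mathbb R$. For a measurable set $S$ put $\mu(S)=\frac1{|S|}\int_S f\,dx$, and define $$E_1(\Omega)=\frac1{|\Omega|}\int_\Omega (f-\mu(\Omega))^2dx,\qquad E_2(\Omega)=\frac1{|\Omega^c|}\int_{\Omega^c}(f-\mu(\Omega^c))^2dx,\qquad E_3(\Omega)=\int_\Gamma d\Gamma,$$ $$E(\Omega)=E_1(\Omega)+E_2(\Omega)+\eta\,E_3(\Omega),$$ where $d\Gamma$ is the arc length, so that $E_3$ is the length of the boundary. Let $T_t:\mathbb R^2\to\mathbb R^2$, $t\in[0,\varepsilon)$, be a family of $C^1$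 diffeomorphisms with $T_0=\mathrm{id}$ and $\Omega_t=T_t(\Omega)\subset D$ for all $t$, such that $\partial_tT_t(x)$ exists, is $C^1$ in $x$, and is continuous in $(t,x)\in[0,\varepsilon)\times\mathbb R^2$ together with its derivative in $x$. Let $V(t,x)=(\partial_tT_t)(T_t^{-1}(x))$ be its Eulerian velocity field, and write $v_n=V(0)\cdot n$ on $\Gamma$. For a shape functional $J$ let $dJ(\Omega;V)=\lim_{t\downarrow0}\frac1t\big(J(\Omega_t)-J(\Omega)\big)$ be its Eulerian derivative. Then the Eulerian derivatives of $E_1,E_2,E_3$ and $E$ at $\Omega$ exist, and $$dE_i(\Omega;V)=\int_\Gamma \delta E_i\,v_n\,d\Gamma\quad(i=1,2,3),\qquad dE(\Omega;V)=\int_\Gamma\delta E\,v_n\,d\Gamma,$$ where, at $x\in\Gamma$, $$\delta E_1(x)=\frac{f(x)^2}{|\Omega|}-\frac1{|\Omega|^2}\Big(\int_\Omega f^2\,dy+2f(x)\int_\Omega f\,dy-\frac2{|\Omega|}\Big(\int_\Omega f\,dy\Big)^2\Big),$$ $$\delta E_2(x)=\frac1{|\Omega^c|^2}\Big(\int_{\Omega^c}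 f^2\,dy+2f(x)\int_{\Omega^c} f\,dy-\frac2{|\Omega^c|}\Big(\int_{\Omega^c} f\,dy\Big)^2\Big)-\frac{f(x)^2}{|\Omega^c|},$$ $$\delta E_3(x)=H(x),\qquad \delta E=\delta E_1+\delta E_2+\eta\,\delta E_3,$$ and $\delta E$ is continuous along $\Gamma$. -/

import Mathlib

open Set Filter Topology MeasureTheory

noncomputable section

namespace MumfordShah

/-- The Euclidean plane. -/
abbrev Plane : Type := EuclideanSpace ℝ (Fin 2)

/-! ### Boundary curves -/

/-- The unit normal to the right of a regular plane curve: the unit tangent turned by `-π/2`.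
It points out of a region that lies to the left of the curve. -/
def rightNormal (γ : ℝ → Plane) (s : ℝ) : Plane :=
  ‖deriv γ s‖⁻¹ • !₂[deriv γ s 1, -(deriv γ s 0)]

/-- The signed curvature `(x' y'' - y' x'') / |γ'|³` of a regular plane curve `γ = (x, y)`; it is
`1 / R` on a circle of radius `R` that is run through counterclockwise. -/
def curvature (γ : ℝ → Plane) (s : ℝ) : ℝ :=
  (deriv γ s 0 * deriv (deriv γ) s 1 - deriv γ s 1 * deriv (deriv γ) s 0) / ‖deriv γ s‖ ^ 3

/-- The integral `∫_Γ g dΓ` with respect to arc length over a closed curve `Γ` with the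
parametrization `γ` of period `ℓ`; the integrand is given as a function of the parameter. -/
def arcIntegral (γ : ℝ → Plane) (ℓ : ℝ) (g : ℝ → ℝ) : ℝ :=
  ∫ s in (0 : ℝ)..ℓ, g s * ‖deriv γ s‖

/-- `Ω` is the bounded open region enclosed by a simple closed regular `C²` curve, which `γ` runs
through once per period `ℓ`, with `Ω` to its left (so that `rightNormal γ` is the outward unit
normal of `Ω`). -/
structure IsJordanRegion (Ω : Set Plane) (γ : ℝ → Plane) (ℓ : ℝ) : Prop where
  isOpen : IsOpen Ω
  isBounded : Bornology.IsBounded Ω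
  period_pos : 0 < ℓ
  periodic : Function.Periodic γ ℓ
  contDiff : ContDiff ℝ 2 γ
  regular : ∀ s, deriv γ s ≠ 0
  simple : InjOn γ (Ico 0 ℓ)
  frontier_eq : frontier Ω = range γ
  outward : ∀ s, ∀ᶠ r in 𝓝[>] (0 : ℝ),
    γ s - r • rightNormal γ s ∈ Ω ∧ γ s + r • rightNormal γ s ∉ Ω

/-! ### Deformations and Eulerian derivatives -/

/-- The velocity `∂ₜ T_t(X)` at time `t ∈ [0, ε)` of the point that starts at `X`
(one-sided at `t = 0`). -/
def lagrangianVelocity (T : ℝ → Plane ≃ Plane) (ε : ℝ) (t : ℝ) (X : Plane) : Plane :=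
  derivWithin (fun s => T s X) (Ico 0 ε) t

/-- The Eulerian velocity field `V(t, x) = (∂ₜ T_t)(T_t⁻¹ x)`. -/
def eulerianVelocity (T : ℝ → Plane ≃ Plane) (ε : ℝ) (t : ℝ) (x : Plane) : Plane :=
  lagrangianVelocity T ε t ((T t).symm x)

/-- A family `T_t`, `t ∈ [0, ε)`, of `C¹` diffeomorphisms of the plane with `T_0 = id` which is
continuously differentiable in `t` with respect to `C¹` convergence on compact sets. -/
structure IsDeformation (T : ℝ → Plane ≃ Plane) (ε : ℝ) : Prop where
  pos : 0 < ε
  zero : ∀ x, T 0 x = x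
  contDiff : ∀ t ∈ Ico 0 ε, ContDiff ℝ 1 (T t)
  contDiff_symm : ∀ t ∈ Ico 0 ε, ContDiff ℝ 1 (T t).symm
  differentiableOn : ∀ X, DifferentiableOn ℝ (fun t => T t X) (Ico 0 ε)
  contDiff_velocity : ∀ t ∈ Ico 0 ε, ContDiff ℝ 1 (lagrangianVelocity T ε t)
  continuousOn_velocity :
    ContinuousOn (fun p : ℝ × Plane => lagrangianVelocity T ε p.1 p.2) (Ico 0 ε ×ˢ univ)
  continuousOn_fderiv_velocity :
    ContinuousOn (fun p : ℝ × Plane => fderiv ℝ (lagrangianVelocity T ε p.1) p.2)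
      (Ico 0 ε ×ˢ univ)

/-- The shape functional `J` has the Eulerian derivative `d = lim_{t ↓ 0} (J(T_t Ω) - J(Ω)) / t`
at `Ω` along the deformation `T`. -/
def HasEulerianDerivative (J : Set Plane → ℝ) (T : ℝ → Plane ≃ Plane) (Ω : Set Plane)
    (d : ℝ) : Prop :=
  Tendsto (fun t : ℝ => (J (T t '' Ω) - J Ω) / t) (𝓝[>] 0) (𝓝 d)

/-! ### The energy -/

/-- The mean `μ(S)` of `f` over `S`. -/
def mean (f : Plane → ℝ) (S : Set Plane) : ℝ :=
  1 / volume.real S * ∫ x in S, f x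

/-- The variance of `f` over `S`. -/
def regionVariance (f : Plane → ℝ) (S : Set Plane) : ℝ :=
  1 / volume.real S * ∫ x in S, (f x - mean f S) ^ 2

/-- The energy of the foreground. -/
def E₁ (f : Plane → ℝ) (Ω : Set Plane) : ℝ := regionVariance f Ω

/-- The energy of the background `D ∖ Ω`. -/
def E₂ (f : Plane → ℝ) (D Ω : Set Plane) : ℝ := regionVariance f (D \ Ω)

/-- The length of the boundary: its one-dimensional Hausdorff measure. -/
def E₃ (Ω : Set Plane) : ℝ := (Measure.hausdorffMeasure 1 : Measure Plane).real (frontier Ω)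

/-- The piecewise constant Mumford–Shah energy. -/
def energy (f : Plane → ℝ) (D : Set Plane) (η : ℝ) (Ω : Set Plane) : ℝ :=
  E₁ f Ω + E₂ f D Ω + η * E₃ Ω

/-! ### The shape gradient -/

/-- The shape gradient of `E₁` at the boundary point `x`. -/
def δE₁ (f : Plane → ℝ) (Ω : Set Plane) (x : Plane) : ℝ :=
  1 / volume.real Ω * f x ^ 2
    - 1 / volume.real Ω ^ 2 * ((∫ y in Ω, f y ^ 2) + 2 * f x * (∫ y in Ω, f y)
      - 2 / volume.real Ω * (∫ y in Ω, f y) ^ 2)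

/-- The shape gradient of `E₂` at the boundary point `x`. -/
def δE₂ (f : Plane → ℝ) (D Ω : Set Plane) (x : Plane) : ℝ :=
  1 / volume.real (D \ Ω) ^ 2 * ((∫ y in D \ Ω, f y ^ 2) + 2 * f x * (∫ y in D \ Ω, f y)
      - 2 / volume.real (D \ Ω) * (∫ y in D \ Ω, f y) ^ 2)
    - 1 / volume.real (D \ Ω) * f x ^ 2

/-- The shape gradient of the energy at the boundary point `γ s`; the length term contributes
`η` times the curvature. -/
def δE (f : Plane → ℝ) (D : Set Plane) (η : ℝ) (Ω : Set Plane) (γ : ℝ → Plane) (s : ℝ) : ℝ :=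
  δE₁ f Ω (γ s) + δE₂ f D Ω (γ s) + η * curvature γ s

/-- The normal velocity `v_n = V(0) · n` at the boundary point `γ s`. -/
def normalVelocity (T : ℝ → Plane ≃ Plane) (ε : ℝ) (γ : ℝ → Plane) (s : ℝ) : ℝ :=
  inner ℝ (eulerianVelocity T ε 0 (γ s)) (rightNormal γ s)

end MumfordShah

end

namespace MumfordShah

/-! ### Uniform expansion of a deformation at time zero -/

/-! Each variance is `Q / A - (I / A) ^ 2` with area `A` and first and second moments `I`, `Q` of
`f`, so its derivative follows from the quotient rule once integrals over the moving region can be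
differentiated.

The transport theorem `hasDerivWithinAt_setIntegral` does this for an integrand `g` that is
integrable on `D` and continuous only at the points of `Γ`; derivatives of `g` are not available.
The regions `T_t Ω` and `Ω` differ only in a tube of width `O(t)` around `Γ`. In the rescaled normal
coordinates `(s, ρ) ↦ γ(s) + tρ n(s)` the Jacobian carries a factor `t` that cancels the `1 / t` of
the difference quotient. For fixed `(s, ρ)` the point lies in `Ω` for small `t` if `ρ < 0`, and in
`T_t Ω` if `ρ < v_n(s)`, and outside if the inequality is reversed. Hence the integrand tends to
`|γ'| g(γ(s)) (1_{ρ < v_n} - 1_{ρ < 0})` almost everywhere, and its integral in `ρ` is `|γ'| g v_n`.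
Dominated convergence concludes. Applied with `g = 1, f, f²`, this gives `E₁`; the background has
the complementary integrals, hence the opposite sign.

For the length, `hausdorffMeasure_range_eq_integral` turns Hausdorff measure into the integral of
the speed. Differentiation under the integral gives the tangential derivative of the velocity
(`hasDerivWithinAt_E₃`), and integration by parts over a period with the Frenet equation converts it
into curvature times normal velocity (`integral_tangential_eq_arcIntegral`).

Both halves rest on `IsDeformation.exists_norm_remainder_le`: on bounded sets `T_t - id - t V(0)` is
`o(t)` uniformly and in Lipschitz seminorm. -/

theorem exists_forall_norm_sub_le_of_continuousOn {E F : Type*} [NormedAddCommGroup E]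
    [NormedAddCommGroup F] {h : ℝ × E → F} {ε : ℝ} (hε : 0 < ε)
    (hh : ContinuousOn h (Ico 0 ε ×ˢ univ)) {K : Set E} (hK : IsCompact K) {κ : ℝ} (hκ : 0 < κ) :
    ∃ t₀ ∈ Ioo 0 ε, ∀ t ∈ Icc 0 t₀, ∀ x ∈ K, ‖h (t, x) - h (0, x)‖ ≤ κ := by
  have hc : IsCompact (Icc 0 (ε / 2) ×ˢ K) := isCompact_Icc.prod hK
  have hu := hc.uniformContinuousOn_of_continuous
    (hh.mono (prod_mono (fun t ht => ⟨ht.1, by linarith [ht.2]⟩) (subset_univ _)))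
  obtain ⟨δ, hδ, H⟩ := Metric.uniformContinuousOn_iff_le.1 hu κ hκ
  refine ⟨min δ (ε / 2), ⟨by positivity, (min_le_right _ _).trans_lt (by linarith)⟩, ?_⟩
  intro t ht x hx
  rw [← dist_eq_norm]
  refine H (t, x) ⟨⟨ht.1, ht.2.trans (min_le_right _ _)⟩, hx⟩ (0, x)
    ⟨⟨le_rfl, by positivity⟩, hx⟩ ?_
  simp only [Prod.dist_eq, dist_self, Real.dist_eq, sub_zero, abs_of_nonneg ht.1]
  exact max_le (ht.2.trans (min_le_left _ _)) hδ.le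

namespace IsDeformation

variable {T : ℝ → Plane ≃ Plane} {ε : ℝ}

theorem hasDerivWithinAt (hT : IsDeformation T ε) (X : Plane) {t : ℝ} (ht : t ∈ Ico 0 ε) :
    HasDerivWithinAt (fun s => T s X) (lagrangianVelocity T ε t X) (Ico 0 ε) t :=
  (hT.differentiableOn X t ht).hasDerivWithinAt

theorem zero_mem (hT : IsDeformation T ε) : (0 : ℝ) ∈ Ico 0 ε := ⟨le_rfl, hT.pos⟩

theorem contDiff_velocity_zero (hT : IsDeformation T ε) :
    ContDiff ℝ 1 (lagrangianVelocity T ε 0) := hT.contDiff_velocity 0 hT.zero_mem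

theorem symm_zero (hT : IsDeformation T ε) (x : Plane) : (T 0).symm x = x := by
  rw [Equiv.symm_apply_eq, hT.zero]

theorem eulerianVelocity_zero (hT : IsDeformation T ε) (x : Plane) :
    eulerianVelocity T ε 0 x = lagrangianVelocity T ε 0 x := by
  rw [eulerianVelocity, hT.symm_zero]

/-- The remainder of the first-order expansion of `T_t` at `t = 0`. -/
noncomputable def remainder (T : ℝ → Plane ≃ Plane) (ε t : ℝ) (x : Plane) : Plane :=
  T t x - x - t • lagrangianVelocity T ε 0 x

theorem hasDerivWithinAt_remainder (hT : IsDeformation T ε) (x : Plane) {t : ℝ}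
    (ht : t ∈ Ico 0 ε) :
    HasDerivWithinAt (fun s => remainder T ε s x)
      (lagrangianVelocity T ε t x - lagrangianVelocity T ε 0 x) (Ico 0 ε) t := by
  have h := ((hT.hasDerivWithinAt x ht).sub_const x).sub
    ((hasDerivWithinAt_id t (Ico 0 ε)).smul_const (lagrangianVelocity T ε 0 x))
  rw [one_smul] at h
  exact h

theorem remainder_zero (hT : IsDeformation T ε) (x : Plane) : remainder T ε 0 x = 0 := by
  simp [remainder, hT.zero]

/-- The time derivative of the remainder is the change of the velocity since time zero, which is
small, and has small Lipschitz constant, on a ball for short times. The mean value inequality in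
time yields both bounds. -/
theorem exists_norm_remainder_le (hT : IsDeformation T ε) (R : ℝ) {κ : ℝ} (hκ : 0 < κ) :
    ∃ t₀ ∈ Ioo 0 ε, ∀ t ∈ Icc 0 t₀,
      (∀ x ∈ Metric.closedBall (0 : Plane) R, ‖remainder T ε t x‖ ≤ κ * t) ∧
      ∀ x ∈ Metric.closedBall (0 : Plane) R, ∀ y ∈ Metric.closedBall (0 : Plane) R,
        ‖remainder T ε t x - remainder T ε t y‖ ≤ κ * t * ‖x - y‖ := by
  have hK := isCompact_closedBall (0 : Plane) R
  obtain ⟨t₁, ht₁, H₁⟩ :=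
    exists_forall_norm_sub_le_of_continuousOn hT.pos hT.continuousOn_velocity hK hκ
  obtain ⟨t₂, ht₂, H₂⟩ :=
    exists_forall_norm_sub_le_of_continuousOn hT.pos hT.continuousOn_fderiv_velocity hK hκ
  have hsub : ∀ t ∈ Icc 0 (min t₁ t₂), t ∈ Ico 0 ε := fun t ht =>
    ⟨ht.1, (ht.2.trans (min_le_left _ _)).trans_lt ht₁.2⟩
  refine ⟨min t₁ t₂, ⟨lt_min ht₁.1 ht₂.1, (min_le_left _ _).trans_lt ht₁.2⟩, fun t ht => ⟨?_, ?_⟩⟩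
  · intro x hx
    have h := (convex_Icc 0 (min t₁ t₂)).norm_image_sub_le_of_norm_hasDerivWithin_le
      (fun s hs => (hT.hasDerivWithinAt_remainder x (hsub s hs)).mono hsub)
      (fun s hs => H₁ s ⟨hs.1, hs.2.trans (min_le_left _ _)⟩ x hx)
      ⟨le_rfl, ht.1.trans ht.2⟩ ht
    simpa [hT.remainder_zero, abs_of_nonneg ht.1] using h
  · intro x hx y hy
    have hb : ∀ s ∈ Icc 0 (min t₁ t₂),
        ‖(lagrangianVelocity T ε s x - lagrangianVelocity T ε 0 x) -
          (lagrangianVelocity T ε s y - lagrangianVelocity T ε 0 y)‖ ≤ κ * ‖x - y‖ := by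
      intro s hs
      have hd : ∀ z, DifferentiableAt ℝ (lagrangianVelocity T ε s) z := fun z =>
        ((hT.contDiff_velocity s (hsub s hs)).differentiable one_ne_zero) z
      have hd0 : ∀ z, DifferentiableAt ℝ (lagrangianVelocity T ε 0) z := fun z =>
        (hT.contDiff_velocity_zero.differentiable one_ne_zero) z
      refine (convex_closedBall (0 : Plane) R).norm_image_sub_le_of_norm_fderiv_le (𝕜 := ℝ)
        (f := fun z => lagrangianVelocity T ε s z - lagrangianVelocity T ε 0 z)
        (fun z _ => (hd z).sub (hd0 z)) (fun z hz => ?_) hy hx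
      rw [fderiv_fun_sub (hd z) (hd0 z)]
      exact H₂ s ⟨hs.1, hs.2.trans (min_le_right _ _)⟩ z hz
    have h := (convex_Icc 0 (min t₁ t₂)).norm_image_sub_le_of_norm_hasDerivWithin_le
      (fun s hs => ((hT.hasDerivWithinAt_remainder x (hsub s hs)).sub
        (hT.hasDerivWithinAt_remainder y (hsub s hs))).mono hsub)
      hb ⟨le_rfl, ht.1.trans ht.2⟩ ht
    simp only [Pi.sub_apply, hT.remainder_zero, sub_zero, Real.norm_eq_abs, abs_of_nonneg ht.1] at h
    linarith

/-- A Lipschitz constant of the remainder bounds its space derivative, so the expansion of `DT_t`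
needs no interchange of time and space derivatives. -/
theorem exists_norm_fderiv_sub_le (hT : IsDeformation T ε) (R : ℝ) {κ : ℝ} (hκ : 0 < κ) :
    ∃ t₀ ∈ Ioo 0 ε, ∀ t ∈ Icc 0 t₀, ∀ x ∈ Metric.ball (0 : Plane) R,
      ‖fderiv ℝ (T t) x - ContinuousLinearMap.id ℝ Plane
        - t • fderiv ℝ (lagrangianVelocity T ε 0) x‖ ≤ κ * t := by
  obtain ⟨t₀, ht₀, H⟩ := hT.exists_norm_remainder_le R hκ
  refine ⟨t₀, ht₀, fun t ht x hx => ?_⟩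
  have hκt : 0 ≤ κ * t := mul_nonneg hκ.le ht.1
  have hd : HasFDerivAt (remainder T ε t) (fderiv ℝ (T t) x - ContinuousLinearMap.id ℝ Plane
        - t • fderiv ℝ (lagrangianVelocity T ε 0) x) x :=
    ((((hT.contDiff t ⟨ht.1, ht.2.trans_lt ht₀.2⟩).differentiable one_ne_zero) x).hasFDerivAt.sub
      (hasFDerivAt_id x)).sub
      (((hT.contDiff_velocity_zero.differentiable one_ne_zero) x).hasFDerivAt.const_smul t)
  have hl : LipschitzOnWith ⟨κ * t, hκt⟩ (remainder T ε t) (Metric.closedBall 0 R) :=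
    LipschitzOnWith.of_dist_le_mul fun y hy z hz => by
      rw [dist_eq_norm, dist_eq_norm]; exact (H t ht).2 y hy z hz
  exact hd.le_of_lipschitzOn
    (mem_of_superset (Metric.isOpen_ball.mem_nhds hx) Metric.ball_subset_closedBall) hl

/-- On bounded sets, `T_t` and its inverse move points by at most a multiple of `t`. -/
theorem exists_norm_symm_sub_le (hT : IsDeformation T ε) (R : ℝ) :
    ∃ C > 0, ∃ t₀ ∈ Ioo 0 ε, ∀ t ∈ Icc 0 t₀,
      (∀ x ∈ Metric.closedBall (0 : Plane) R, ‖T t x - x‖ ≤ C * t) ∧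
      ∀ x ∈ Metric.closedBall (0 : Plane) R,
        ‖(T t).symm x‖ ≤ R + 1 ∧ ‖(T t).symm x - x‖ ≤ C * t := by
  set K := Metric.closedBall (0 : Plane) (R + 1)
  have hK : IsCompact K := isCompact_closedBall _ _
  obtain ⟨M, hM⟩ := hK.exists_bound_of_continuousOn
    hT.contDiff_velocity_zero.continuous.continuousOn
  obtain ⟨L, hL⟩ := hK.exists_bound_of_continuousOn
    (hT.contDiff_velocity_zero.continuous_fderiv one_ne_zero).continuousOn
  obtain ⟨t₁, ht₁, H⟩ := hT.exists_norm_remainder_le (R + 1) one_pos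
  have hmove : ∀ t ∈ Icc 0 t₁, ∀ x ∈ K, ‖T t x - x‖ ≤ (|M| + 1) * t := by
    intro t ht x hx
    have h1 := (H t ht).1 x hx
    have h2 : ‖t • lagrangianVelocity T ε 0 x‖ ≤ |M| * t := by
      rw [norm_smul, Real.norm_eq_abs, abs_of_nonneg ht.1, mul_comm]
      exact mul_le_mul_of_nonneg_right ((hM x hx).trans (le_abs_self _)) ht.1
    calc ‖T t x - x‖ = ‖remainder T ε t x + t • lagrangianVelocity T ε 0 x‖ := by
          simp [remainder]
      _ ≤ _ := (norm_add_le _ _).trans (by linarith)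
  set N := |M| + |L| + 1
  have hN : 1 ≤ N := by have := abs_nonneg M; have := abs_nonneg L; simp only [N]; linarith
  -- The second bound on `t` makes `N * t ≤ 1 / 2`, so that both the displacement and the Lipschitz
  -- constant of `T t - id` are at most `1 / 2`.
  refine ⟨|M| + 1, by positivity, min t₁ (1 / (2 * N)),
    ⟨lt_min ht₁.1 (by positivity), (min_le_left _ _).trans_lt ht₁.2⟩, fun t ht => ?_⟩
  have ht1 : t ∈ Icc 0 t₁ := ⟨ht.1, ht.2.trans (min_le_left _ _)⟩
  have htN : N * t ≤ 1 / 2 := by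
    have := ht.2.trans (min_le_right _ _)
    rw [le_div_iff₀ (by positivity)] at this
    linarith
  refine ⟨fun x hx => hmove t ht1 x (Metric.closedBall_subset_closedBall (by linarith) hx),
    fun x hx => ?_⟩
  have hxR : ‖x‖ ≤ R := by simpa using hx
  -- By the quantitative inverse function theorem the image of the unit ball around `x` contains the
  -- ball of radius `1 / 2` around `T t x`, hence `x` itself. So the preimage of `x` is within
  -- distance `1` and the displacement bound on the ball of radius `R + 1` applies to it.
  have happ : ApproximatesLinearOn (T t) (ContinuousLinearEquiv.refl ℝ Plane : Plane →L[ℝ] Plane)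
      (Metric.closedBall x 1) (1 / 2) := by
    have hsub : Metric.closedBall x 1 ⊆ K := fun y hy => by
      have h1 : ‖y - x‖ ≤ 1 := by simpa [dist_eq_norm] using hy
      have : ‖y‖ ≤ ‖x‖ + ‖y - x‖ := norm_le_norm_add_norm_sub' y x
      simpa [K] using (by linarith : ‖y‖ ≤ R + 1)
    intro y hy z hz
    have h1 := (H t ht1).2 y (hsub hy) z (hsub hz)
    have h2 : ‖lagrangianVelocity T ε 0 y - lagrangianVelocity T ε 0 z‖ ≤ |L| * ‖y - z‖ :=
      (convex_closedBall (0 : Plane) (R + 1)).norm_image_sub_le_of_norm_fderiv_le (𝕜 := ℝ)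
        (fun w _ => (hT.contDiff_velocity_zero.differentiable one_ne_zero) w)
        (fun w hw => (hL w hw).trans (le_abs_self _)) (hsub hz) (hsub hy)
    have h3 : T t y - T t z - (y - z) = (remainder T ε t y - remainder T ε t z) +
        t • (lagrangianVelocity T ε 0 y - lagrangianVelocity T ε 0 z) := by
      simp only [remainder, smul_sub]; abel
    have h4 : ‖t • (lagrangianVelocity T ε 0 y - lagrangianVelocity T ε 0 z)‖ ≤
        t * (|L| * ‖y - z‖) := by
      rw [norm_smul, Real.norm_eq_abs, abs_of_nonneg ht.1]
      exact mul_le_mul_of_nonneg_left h2 ht.1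
    have h5 : (|L| + 1) * t ≤ 1 / 2 := by
      refine le_trans (mul_le_mul_of_nonneg_right ?_ ht.1) htN
      have := abs_nonneg M; simp only [N]; linarith
    have h6 := mul_le_mul_of_nonneg_right h5 (norm_nonneg (y - z))
    change ‖T t y - T t z - (y - z)‖ ≤ _
    rw [h3]
    refine (norm_add_le _ _).trans ?_
    push_cast
    linarith
  have hs := happ.surjOn_closedBall_of_nonlinearRightInverse
    (ContinuousLinearEquiv.refl ℝ Plane).toNonlinearRightInverse zero_le_one subset_rfl
  have hle : ((ContinuousLinearEquiv.refl ℝ Plane).toNonlinearRightInverse.nnnorm : ℝ) ≤ 1 := by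
    change ‖(ContinuousLinearMap.id ℝ Plane)‖ ≤ 1
    exact ContinuousLinearMap.norm_id_le
  have hpos : 0 < ((ContinuousLinearEquiv.refl ℝ Plane).toNonlinearRightInverse.nnnorm : ℝ) := by
    change 0 < ‖(ContinuousLinearMap.id ℝ Plane)‖
    rw [ContinuousLinearMap.norm_id]; exact one_pos
  have hinv := (one_le_inv₀ hpos).2 hle
  have hmem : x ∈ Metric.closedBall (T t x)
      ((((ContinuousLinearEquiv.refl ℝ Plane).toNonlinearRightInverse.nnnorm : ℝ)⁻¹ -
        ((1 / 2 : NNReal) : ℝ)) * 1) := by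
    rw [mem_closedBall_iff_norm']
    have h1 := hmove t ht1 x (Metric.closedBall_subset_closedBall (by linarith) hx)
    have h5 : (|M| + 1) * t ≤ 1 / 2 := by
      refine le_trans (mul_le_mul_of_nonneg_right ?_ ht.1) htN
      have := abs_nonneg L; simp only [N]; linarith
    push_cast
    linarith
  obtain ⟨y, hy, hyx⟩ := hs hmem
  have hsy : (T t).symm x = y := by rw [Equiv.symm_apply_eq, hyx]
  have h1 : ‖y - x‖ ≤ 1 := by simpa [dist_eq_norm] using hy
  have h2 : ‖y‖ ≤ R + 1 := by linarith [norm_le_norm_add_norm_sub' y x]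
  rw [hsy]
  refine ⟨h2, ?_⟩
  have := hmove t ht1 y (by simpa [K] using h2)
  rwa [hyx, norm_sub_rev] at this

theorem tendsto_inv_smul_remainder (hT : IsDeformation T ε) {y : ℝ → Plane} {R : ℝ}
    (hy : ∀ᶠ t in 𝓝[>] (0 : ℝ), ‖y t‖ ≤ R) :
    Tendsto (fun t => t⁻¹ • remainder T ε t (y t)) (𝓝[>] 0) (𝓝 0) := by
  rw [Metric.tendsto_nhds]
  intro κ hκ
  obtain ⟨t₀, ht₀, H⟩ := hT.exists_norm_remainder_le R (half_pos hκ)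
  filter_upwards [hy, Ioc_mem_nhdsGT ht₀.1] with t hyt ht
  have h := (H t ⟨ht.1.le, ht.2⟩).1 (y t) (by simpa using hyt)
  rw [dist_zero_right, norm_smul, norm_inv, Real.norm_eq_abs, abs_of_pos ht.1]
  rw [inv_mul_lt_iff₀ ht.1]
  nlinarith [ht.1]

/-- The inverse deformation has the velocity `-V(0)` at time zero, also along moving points. -/
theorem hasDerivWithinAt_symm (hT : IsDeformation T ε) {x : ℝ → Plane} {x' : Plane}
    (hx : HasDerivWithinAt x x' (Ioi 0) 0) :
    HasDerivWithinAt (fun t => (T t).symm (x t)) (x' - lagrangianVelocity T ε 0 (x 0))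
      (Ioi 0) 0 := by
  have hxc : Tendsto x (𝓝[>] 0) (𝓝 (x 0)) := hx.continuousWithinAt
  obtain ⟨C, -, t₀, ht₀, H⟩ := hT.exists_norm_symm_sub_le (‖x 0‖ + 1)
  have hev : ∀ᶠ t in 𝓝[>] (0 : ℝ), ‖x t‖ ≤ ‖x 0‖ + 1 :=
    (hxc.norm.eventually_lt_const (lt_add_one _)).mono fun _ h => h.le
  have hbd : ∀ᶠ t in 𝓝[>] (0 : ℝ), ‖(T t).symm (x t)‖ ≤ ‖x 0‖ + 1 + 1 := by
    filter_upwards [hev, Ioc_mem_nhdsGT ht₀.1] with t h1 ht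
    exact ((H t ⟨ht.1.le, ht.2⟩).2 (x t) (by simpa using h1)).1
  have hyc : Tendsto (fun t => (T t).symm (x t)) (𝓝[>] 0) (𝓝 (x 0)) := by
    have h0 : Tendsto (fun t => (T t).symm (x t) - x t) (𝓝[>] 0) (𝓝 0) := by
      have hC : Tendsto (fun t : ℝ => C * t) (𝓝[>] 0) (𝓝 0) := by
        have : Tendsto (fun t : ℝ => C * t) (𝓝 0) (𝓝 (C * 0)) :=
          (continuous_const.mul continuous_id).tendsto 0
        simpa using this.mono_left nhdsWithin_le_nhds
      refine squeeze_zero_norm' ?_ hC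
      filter_upwards [hev, Ioc_mem_nhdsGT ht₀.1] with t h1 ht
      exact ((H t ⟨ht.1.le, ht.2⟩).2 (x t) (by simpa using h1)).2
    simpa using h0.add hxc
  rw [hasDerivWithinAt_iff_tendsto_slope' (by simp)] at hx ⊢
  have hW := (hT.contDiff_velocity_zero.continuous.tendsto (x 0)).comp hyc
  -- With `y = T_t⁻¹ x`, the expansion `x = y + t V(0, y) + o(t)` is solved for the difference
  -- quotient of `y`.
  have hlim := (hx.sub hW).sub (hT.tendsto_inv_smul_remainder hbd)
  rw [sub_zero] at hlim
  refine hlim.congr' ?_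
  filter_upwards [self_mem_nhdsWithin] with t ht
  have ht0 : t ≠ 0 := ne_of_gt ht
  simp only [slope_def_module, sub_zero, Function.comp_apply, remainder, hT.symm_zero,
    Equiv.apply_symm_apply, smul_sub, smul_smul, inv_mul_cancel₀ ht0, one_smul]
  abel

end IsDeformation
/-! ### The moving frame of a regular plane curve -/

theorem inner_plane (v w : Plane) : inner ℝ v w = v 0 * w 0 + v 1 * w 1 := by
  simp [PiLp.inner_apply, Fin.sum_univ_two, mul_comm]

theorem norm_sq_plane (v : Plane) : ‖v‖ ^ 2 = v 0 ^ 2 + v 1 ^ 2 := by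
  rw [← real_inner_self_eq_norm_sq, inner_plane]; ring

theorem contDiff_plane_mk {E : Type*} [NormedAddCommGroup E] [NormedSpace ℝ E] {n : WithTop ℕ∞}
    {a b : E → ℝ} (ha : ContDiff ℝ n a) (hb : ContDiff ℝ n b) :
    ContDiff ℝ n fun s => (!₂[a s, b s] : Plane) := by
  rw [contDiff_euclidean]
  intro i
  fin_cases i
  · simpa using ha
  · simpa using hb

section Frame

variable {γ : ℝ → Plane} {s : ℝ}

@[simp] theorem rightNormal_apply_zero (γ : ℝ → Plane) (s : ℝ) :
    rightNormal γ s 0 = ‖deriv γ s‖⁻¹ * deriv γ s 1 := by simp [rightNormal]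

@[simp] theorem rightNormal_apply_one (γ : ℝ → Plane) (s : ℝ) :
    rightNormal γ s 1 = -(‖deriv γ s‖⁻¹ * deriv γ s 0) := by simp [rightNormal]

theorem inner_deriv_rightNormal (γ : ℝ → Plane) (s : ℝ) :
    inner ℝ (deriv γ s) (rightNormal γ s) = 0 := by
  rw [inner_plane]; simp; ring

theorem inner_rightNormal_self (h : deriv γ s ≠ 0) :
    inner ℝ (rightNormal γ s) (rightNormal γ s) = 1 := by
  have h0 : ‖deriv γ s‖ ≠ 0 := norm_ne_zero_iff.2 h
  rw [inner_plane, rightNormal_apply_zero, rightNormal_apply_one]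
  field_simp
  rw [norm_sq_plane]; ring

theorem norm_rightNormal (h : deriv γ s ≠ 0) : ‖rightNormal γ s‖ = 1 := by
  have h1 := inner_rightNormal_self h
  rw [real_inner_self_eq_norm_sq] at h1
  exact (pow_eq_one_iff_of_nonneg (norm_nonneg _) two_ne_zero).1 h1

theorem eq_tangential_add_normal (h : deriv γ s ≠ 0) (v : Plane) :
    (inner ℝ v (deriv γ s) / ‖deriv γ s‖ ^ 2) • deriv γ s
      + (inner ℝ v (rightNormal γ s) : ℝ) • rightNormal γ s = v := by
  have h0 : ‖deriv γ s‖ ≠ 0 := norm_ne_zero_iff.2 h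
  have hq := norm_sq_plane (deriv γ s)
  simp only [inner_plane, rightNormal_apply_zero, rightNormal_apply_one]
  ext i
  fin_cases i
  · simp
    field_simp
    rw [hq]; ring
  · simp
    field_simp
    rw [hq]; ring

/-- The coordinates `(a, b) ↦ a γ'(s) + b n(s)` of the moving frame. -/
noncomputable def frameEquiv (h : deriv γ s ≠ 0) : (ℝ × ℝ) ≃L[ℝ] Plane :=
  ContinuousLinearEquiv.equivOfInverse
    ((ContinuousLinearMap.fst ℝ ℝ ℝ).smulRight (deriv γ s)
      + (ContinuousLinearMap.snd ℝ ℝ ℝ).smulRight (rightNormal γ s))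
    (((‖deriv γ s‖ ^ 2)⁻¹ • innerSL ℝ (deriv γ s)).prod (innerSL ℝ (rightNormal γ s)))
    (by
      intro p
      have h0 : ‖deriv γ s‖ ≠ 0 := norm_ne_zero_iff.2 h
      have h1 := inner_deriv_rightNormal γ s
      have h2 : inner ℝ (rightNormal γ s) (deriv γ s) = 0 := by rw [real_inner_comm, h1]
      ext
      · simp [inner_add_right, inner_smul_right, h1]
        field_simp
      · simp [inner_add_right, inner_smul_right, h2, norm_rightNormal h])
    (by
      intro v
      have := eq_tangential_add_normal h v
      simpa [real_inner_comm, div_eq_inv_mul] using this)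

theorem frameEquiv_apply (h : deriv γ s ≠ 0) (p : ℝ × ℝ) :
    frameEquiv h p = p.1 • deriv γ s + p.2 • rightNormal γ s := rfl

theorem frameEquiv_symm_apply_snd (h : deriv γ s ≠ 0) (v : Plane) :
    ((frameEquiv h).symm v).2 = inner ℝ v (rightNormal γ s) := by
  change inner ℝ (rightNormal γ s) v = _
  exact real_inner_comm _ _

end Frame

/-! ### Crossing the frontier of an open set. -/

theorem subset_of_disjoint_frontier {X : Type*} [TopologicalSpace X] {S U : Set X}
    (hS : IsPreconnected S) (hU : IsOpen U) (hne : (S ∩ U).Nonempty)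
    (hd : ∀ x ∈ S, x ∉ frontier U) : S ⊆ U := by
  refine hS.subset_of_closure_inter_subset hU hne fun x hx => ?_
  by_contra h
  exact hd x hx.2 (by rw [hU.frontier_eq]; exact ⟨hx.1, h⟩)

/-- The segment from `x` to `y` leaves the open set and so meets the frontier, at a point no farther
from either end than the length of the segment. -/
theorem infDist_frontier_le {E : Type*} [NormedAddCommGroup E] [NormedSpace ℝ E] {U : Set E}
    (hU : IsOpen U) {x y : E} (hx : x ∈ U) (hy : y ∉ U) (z : E) (hz : z = x ∨ z = y) :
    Metric.infDist z (frontier U) ≤ ‖x - y‖ := by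
  by_contra! h
  refine hy (subset_of_disjoint_frontier (convex_segment x y).isPreconnected hU
    ⟨x, left_mem_segment ℝ x y, hx⟩ (fun w hw hwf => ?_) (right_mem_segment ℝ x y))
  have h1 := Metric.infDist_le_dist_of_mem (x := z) hwf
  have h2 := dist_add_dist_of_mem_segment hw
  rw [dist_eq_norm x y] at h2
  rcases hz with rfl | rfl
  · linarith [dist_nonneg (x := w) (y := y)]
  · rw [dist_comm] at h1; linarith [dist_nonneg (x := x) (y := w)]

/-! ### The tubular neighbourhood -/

/-- The normal coordinates `(s, r) ↦ γ(s) + r n(s)` along `γ`. -/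
noncomputable def tubeMap (γ : ℝ → Plane) (p : ℝ × ℝ) : Plane := γ p.1 + p.2 • rightNormal γ p.1

@[simp] theorem tubeMap_zero (γ : ℝ → Plane) (s : ℝ) : tubeMap γ (s, 0) = γ s := by
  simp [tubeMap]

namespace IsJordanRegion

variable {Ω : Set Plane} {γ : ℝ → Plane} {ℓ : ℝ}

theorem contDiff_deriv (hΩ : IsJordanRegion Ω γ ℓ) : ContDiff ℝ 1 (deriv γ) := by
  have h : ContDiff ℝ (1 + 1) γ := by simpa [one_add_one_eq_two] using hΩ.contDiff
  exact (contDiff_succ_iff_deriv.1 h).2.2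

theorem hasDerivAt (hΩ : IsJordanRegion Ω γ ℓ) (s : ℝ) : HasDerivAt γ (deriv γ s) s :=
  (hΩ.contDiff.differentiable two_ne_zero s).hasDerivAt

theorem continuous_curve (hΩ : IsJordanRegion Ω γ ℓ) : Continuous γ := hΩ.contDiff.continuous

theorem contDiff_norm_deriv (hΩ : IsJordanRegion Ω γ ℓ) : ContDiff ℝ 1 fun s => ‖deriv γ s‖ :=
  hΩ.contDiff_deriv.norm ℝ hΩ.regular

theorem norm_deriv_pos (hΩ : IsJordanRegion Ω γ ℓ) (s : ℝ) : 0 < ‖deriv γ s‖ :=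
  norm_pos_iff.2 (hΩ.regular s)

theorem contDiff_deriv_apply (hΩ : IsJordanRegion Ω γ ℓ) (i : Fin 2) :
    ContDiff ℝ 1 fun s => deriv γ s i := contDiff_euclidean.1 hΩ.contDiff_deriv i

theorem contDiff_rightNormal (hΩ : IsJordanRegion Ω γ ℓ) : ContDiff ℝ 1 (rightNormal γ) :=
  (hΩ.contDiff_norm_deriv.inv fun s => (hΩ.norm_deriv_pos s).ne').smul
    (contDiff_plane_mk (hΩ.contDiff_deriv_apply 1) (hΩ.contDiff_deriv_apply 0).neg)

theorem contDiff_tubeMap (hΩ : IsJordanRegion Ω γ ℓ) : ContDiff ℝ 1 (tubeMap γ) :=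
  ((hΩ.contDiff.of_le one_le_two).comp contDiff_fst).add
    (contDiff_snd.smul (hΩ.contDiff_rightNormal.comp contDiff_fst))

/-- On the zero section the contribution of the derivative of the normal vanishes, which leaves the
invertible moving frame. -/
theorem fderiv_tubeMap_zero (hΩ : IsJordanRegion Ω γ ℓ) (s : ℝ) :
    fderiv ℝ (tubeMap γ) (s, 0) = frameEquiv (hΩ.regular s) := by
  have h1 : HasFDerivAt (fun p : ℝ × ℝ => γ p.1)
      ((ContinuousLinearMap.fst ℝ ℝ ℝ).smulRight (deriv γ s)) (s, 0) := by
    refine (HasFDerivAt.comp (g := γ) ((s, 0) : ℝ × ℝ) (hΩ.hasDerivAt s).hasFDerivAt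
      (hasFDerivAt_fst (𝕜 := ℝ) (E := ℝ) (F := ℝ))).congr_fderiv ?_
    ext <;> simp
  have h2 : HasFDerivAt (fun p : ℝ × ℝ => rightNormal γ p.1)
      ((fderiv ℝ (rightNormal γ) s).comp (ContinuousLinearMap.fst ℝ ℝ ℝ)) (s, 0) :=
    HasFDerivAt.comp (g := rightNormal γ) ((s, 0) : ℝ × ℝ)
      (hΩ.contDiff_rightNormal.differentiable one_ne_zero s).hasFDerivAt
      (hasFDerivAt_fst (𝕜 := ℝ) (E := ℝ) (F := ℝ))
  have h3 : HasFDerivAt (fun p : ℝ × ℝ => p.2) (ContinuousLinearMap.snd ℝ ℝ ℝ) (s, 0) :=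
    hasFDerivAt_snd
  refine ((h1.add (h3.smul h2)).congr_fderiv ?_).fderiv
  ext p <;> simp [frameEquiv_apply]

theorem hasStrictFDerivAt_tubeMap (hΩ : IsJordanRegion Ω γ ℓ) (s : ℝ) :
    HasStrictFDerivAt (tubeMap γ) (frameEquiv (hΩ.regular s) : (ℝ × ℝ) →L[ℝ] Plane) (s, 0) := by
  rw [← hΩ.fderiv_tubeMap_zero]
  exact hΩ.contDiff_tubeMap.contDiffAt.hasStrictFDerivAt one_ne_zero

theorem periodic_deriv (hΩ : IsJordanRegion Ω γ ℓ) : Function.Periodic (deriv γ) ℓ := by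
  intro s
  have h : (fun x => γ (x + ℓ)) = γ := funext hΩ.periodic
  rw [← deriv_comp_add_const, h]

theorem periodic_rightNormal (hΩ : IsJordanRegion Ω γ ℓ) :
    Function.Periodic (rightNormal γ) ℓ := by
  intro s
  simp only [rightNormal, hΩ.periodic_deriv s]

theorem isCompact_range (hΩ : IsJordanRegion Ω γ ℓ) : IsCompact (range γ) := by
  rw [← hΩ.periodic.image_Icc hΩ.period_pos 0]
  exact isCompact_Icc.image hΩ.continuous_curve

/-- The normal coordinates are injective, up to the period, on a tube of positive width. -/
theorem exists_injective_tube (hΩ : IsJordanRegion Ω γ ℓ) :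
    ∃ δ > 0, ∀ s s' r r' : ℝ, |r| < δ → |r'| < δ → tubeMap γ (s, r) = tubeMap γ (s', r') →
      (s : AddCircle ℓ) = s' ∧ r = r' := by
  have : Fact (0 < ℓ) := ⟨hΩ.period_pos⟩
  have hc : Continuous hΩ.periodic.lift := hΩ.continuous_curve.quotient_lift _
  have hn : Continuous hΩ.periodic_rightNormal.lift :=
    hΩ.contDiff_rightNormal.continuous.quotient_lift _
  -- Over the circle the zero section is compact and the coordinates are injective on it, not merely
  -- up to the period.
  let Φ : AddCircle ℓ × ℝ → Plane := fun p =>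
    hΩ.periodic.lift p.1 + p.2 • hΩ.periodic_rightNormal.lift p.1
  have hΦc : Continuous Φ :=
    (hc.comp continuous_fst).add (continuous_snd.smul (hn.comp continuous_fst))
  have hΦ : ∀ s r : ℝ, Φ ((s : AddCircle ℓ), r) = tubeMap γ (s, r) := fun s r => rfl
  have hinj : InjOn Φ (univ ×ˢ {0}) := by
    rintro ⟨a, r⟩ ⟨-, hr⟩ ⟨b, r'⟩ ⟨-, hr'⟩ hab
    obtain rfl : r = 0 := hr
    obtain rfl : r' = 0 := hr'
    obtain ⟨x, hx, rfl⟩ : ∃ x ∈ Ico 0 ℓ, (x : AddCircle ℓ) = a := by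
      have := AddCircle.coe_image_Ico_eq ℓ 0
      rw [zero_add] at this
      exact (this ▸ mem_univ a : a ∈ ((↑) : ℝ → AddCircle ℓ) '' Ico 0 ℓ)
    obtain ⟨y, hy, rfl⟩ : ∃ x ∈ Ico 0 ℓ, (x : AddCircle ℓ) = b := by
      have := AddCircle.coe_image_Ico_eq ℓ 0
      rw [zero_add] at this
      exact (this ▸ mem_univ b : b ∈ ((↑) : ℝ → AddCircle ℓ) '' Ico 0 ℓ)
    rw [hΦ, hΦ, tubeMap_zero, tubeMap_zero] at hab
    rw [hΩ.simple hx hy hab]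
  have hloc : ∀ p ∈ (univ : Set (AddCircle ℓ)) ×ˢ ({0} : Set ℝ), ∃ u ∈ 𝓝 p, InjOn Φ u := by
    rintro ⟨a, r⟩ ⟨-, hr⟩
    obtain rfl : r = 0 := hr
    induction a using QuotientAddGroup.induction_on with
    | H s =>
    obtain ⟨u, hu, hinju⟩ : ∃ u ∈ 𝓝 ((s, 0) : ℝ × ℝ), InjOn (tubeMap γ) u :=
      ⟨_, (hΩ.hasStrictFDerivAt_tubeMap s).toOpenPartialHomeomorph _ |>.open_source.mem_nhds
        (hΩ.hasStrictFDerivAt_tubeMap s).mem_toOpenPartialHomeomorph_source,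
        ((hΩ.hasStrictFDerivAt_tubeMap s).toOpenPartialHomeomorph _).injOn⟩
    refine ⟨Prod.map ((↑) : ℝ → AddCircle ℓ) id '' u, ?_, ?_⟩
    · exact (QuotientAddGroup.isOpenMap_coe.prodMap IsOpenMap.id).image_mem_nhds hu
    · rintro _ ⟨p, hp, rfl⟩ _ ⟨q, hq, rfl⟩ hpq
      rw [hinju hp hq hpq]
  -- Injectivity on a compact set together with local injectivity gives injectivity on a
  -- neighbourhood; the tube lemma then provides a width independent of `s`.
  obtain ⟨t, ht, hti⟩ := hinj.exists_mem_nhdsSet (isCompact_univ.prod isCompact_singleton)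
    (fun x _ => hΦc.continuousAt) hloc
  obtain ⟨u, v, -, hv, hu0, hv0, huv⟩ :=
    generalized_tube_lemma (isCompact_univ (X := AddCircle ℓ)) (isCompact_singleton (x := (0 : ℝ)))
      isOpen_interior (subset_interior_iff_mem_nhdsSet.2 ht)
  obtain ⟨δ, hδ, hball⟩ := Metric.isOpen_iff.1 hv 0 (hv0 rfl)
  refine ⟨δ, hδ, fun s s' r r' hr hr' h => ?_⟩
  have hm : ∀ s r : ℝ, |r| < δ → ((s : AddCircle ℓ), r) ∈ t := fun s r hr =>
    interior_subset (huv ⟨hu0 (mem_univ _), hball (by simpa using hr)⟩)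
  exact Prod.ext_iff.1 (hti (hm s r hr) (hm s' r' hr') h)

/-- Every point of the plane lies on the normal at a closest point of the curve. -/
theorem exists_eq_tubeMap (hΩ : IsJordanRegion Ω γ ℓ) (x : Plane) :
    ∃ s ∈ Ioc 0 ℓ, ∃ r, |r| = Metric.infDist x (range γ) ∧ x = tubeMap γ (s, r) := by
  obtain ⟨y, hy, hxy⟩ := hΩ.isCompact_range.exists_infDist_eq_dist (range_nonempty γ) x
  have h0 := hΩ.periodic.image_Ioc hΩ.period_pos 0
  rw [← h0] at hy
  obtain ⟨s, hs, rfl⟩ := hy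
  rw [zero_add] at hs
  -- The squared distance is critical at the closest point, so `x - γ s` is orthogonal to the
  -- tangent and only its normal component survives.
  have hmin : IsLocalMin (fun u => ‖x - γ u‖ ^ 2) s := by
    refine Filter.Eventually.of_forall fun u => ?_
    have h1 : dist x (γ s) ≤ dist x (γ u) := hxy ▸ Metric.infDist_le_dist_of_mem (mem_range_self u)
    rw [dist_eq_norm, dist_eq_norm] at h1
    exact pow_le_pow_left₀ (norm_nonneg _) h1 2
  have hd : HasDerivAt (fun u => ‖x - γ u‖ ^ 2) (2 * inner ℝ (x - γ s) (-deriv γ s)) s :=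
    ((hΩ.hasDerivAt s).const_sub x).norm_sq
  have h1 := hmin.hasDerivAt_eq_zero hd
  have h2 : inner ℝ (x - γ s) (deriv γ s) = 0 := by
    rw [inner_neg_right] at h1; linarith
  have h3 := eq_tangential_add_normal (hΩ.regular s) (x - γ s)
  rw [h2, zero_div, zero_smul, zero_add] at h3
  refine ⟨s, hs, inner ℝ (x - γ s) (rightNormal γ s), ?_, ?_⟩
  · rw [hxy, dist_eq_norm]
    conv_rhs => rw [← h3]
    rw [norm_smul, norm_rightNormal (hΩ.regular s), mul_one, Real.norm_eq_abs]
  · simp [tubeMap, h3]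

/-- By injectivity the two open halves of the tube miss the curve, and they are connected, so each
lies on one side of the frontier. Which side is decided by the `outward` condition at the single
parameter `0`. -/
theorem exists_tube (hΩ : IsJordanRegion Ω γ ℓ) :
    ∃ δ > 0, InjOn (tubeMap γ) (Ioc 0 ℓ ×ˢ Ioo (-δ) δ) ∧
      ∀ s r : ℝ, |r| < δ → (r < 0 → tubeMap γ (s, r) ∈ Ω) ∧ (0 < r → tubeMap γ (s, r) ∉ Ω) := by
  have : Fact (0 < ℓ) := ⟨hΩ.period_pos⟩
  obtain ⟨δ, hδ, H⟩ := hΩ.exists_injective_tube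
  have hoff : ∀ s r : ℝ, |r| < δ → r ≠ 0 → tubeMap γ (s, r) ∉ frontier Ω := by
    intro s r hr hr0 h
    rw [hΩ.frontier_eq] at h
    obtain ⟨u, hu⟩ := h
    rw [← tubeMap_zero γ u] at hu
    exact hr0 (H u s 0 r (by simpa using hδ) hr hu).2.symm
  have hconn : ∀ I : Set ℝ, IsPreconnected I → IsPreconnected (tubeMap γ '' (univ ×ˢ I)) :=
    fun I hI => (isPreconnected_univ.prod hI).image _ hΩ.contDiff_tubeMap.continuous.continuousOn
  have hev := (hΩ.outward 0).and (Ioo_mem_nhdsGT hδ)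
  obtain ⟨ρ, ⟨hin, hout⟩, hρ⟩ := hev.exists
  refine ⟨δ, hδ, ?_, fun s r hr => ⟨fun hr0 => ?_, fun hr0 hmem => ?_⟩⟩
  · rintro ⟨s, r⟩ ⟨hs, hr⟩ ⟨s', r'⟩ ⟨hs', hr'⟩ h
    obtain ⟨h1, h2⟩ := H s s' r r' (abs_lt.2 hr) (abs_lt.2 hr') h
    rw [AddCircle.coe_eq_coe_iff_of_mem_Ioc (a := 0) (by simpa using hs) (by simpa using hs')] at h1
    rw [h1, h2]
  · have hsub : tubeMap γ '' (univ ×ˢ Ioo (-δ) 0) ⊆ Ω := by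
      refine subset_of_disjoint_frontier (hconn _ isPreconnected_Ioo) hΩ.isOpen ?_ ?_
      · refine ⟨_, ⟨(0, -ρ), ⟨mem_univ _, by simpa using hρ.2, by simpa using hρ.1⟩, rfl⟩, ?_⟩
        simpa [tubeMap, sub_eq_add_neg] using hin
      · rintro _ ⟨⟨u, v⟩, ⟨-, hv⟩, rfl⟩
        exact hoff u v (abs_lt.2 ⟨hv.1, hv.2.trans hδ⟩) hv.2.ne
    exact hsub ⟨(s, r), ⟨mem_univ _, (abs_lt.1 hr).1, hr0⟩, rfl⟩
  · have hsub : tubeMap γ '' (univ ×ˢ Ioo 0 δ) ⊆ Ω := by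
      refine subset_of_disjoint_frontier (hconn _ isPreconnected_Ioo) hΩ.isOpen ?_ ?_
      · exact ⟨_, ⟨(s, r), ⟨mem_univ _, hr0, (abs_lt.1 hr).2⟩, rfl⟩, hmem⟩
      · rintro _ ⟨⟨u, v⟩, ⟨-, hv⟩, rfl⟩
        exact hoff u v (abs_lt.2 ⟨by linarith [hv.1], hv.2⟩) hv.1.ne'
    exact hout (hsub ⟨(0, ρ), ⟨mem_univ _, hρ⟩, rfl⟩)

/-- A curve that leaves a boundary point with an inward (outward) velocity enters (leaves) the
region. -/
theorem eventually_mem_or_notMem (hΩ : IsJordanRegion Ω γ ℓ) {y : ℝ → Plane} {w : Plane} {s : ℝ}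
    (hy : HasDerivWithinAt y w (Ioi 0) 0) (hy0 : y 0 = γ s) :
    (inner ℝ w (rightNormal γ s) < 0 → ∀ᶠ t in 𝓝[>] (0 : ℝ), y t ∈ Ω) ∧
      (0 < inner ℝ w (rightNormal γ s) → ∀ᶠ t in 𝓝[>] (0 : ℝ), y t ∉ Ω) := by
  obtain ⟨δ, hδ, -, H⟩ := hΩ.exists_tube
  have hs := hΩ.hasStrictFDerivAt_tubeMap s
  -- The second component of the local inverse is the signed normal coordinate. Along `y` it starts
  -- at `0` with derivative `inner ℝ w n`, so its sign for small `t`, and with it the side of the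
  -- curve, is that of the inner product.
  set Ψ := hs.localInverse (tubeMap γ) (frameEquiv (hΩ.regular s)) (s, 0)
  have hγ : tubeMap γ (s, 0) = y 0 := by rw [tubeMap_zero, hy0]
  have hΨ0 : Ψ (y 0) = (s, 0) := by
    rw [← hγ]; exact hs.localInverse_apply_image
  have hΨ : HasFDerivAt Ψ ((frameEquiv (hΩ.regular s)).symm : Plane →L[ℝ] ℝ × ℝ) (y 0) := by
    rw [← hγ]; exact hs.to_localInverse.hasFDerivAt
  have hd : HasDerivWithinAt (fun t => (Ψ (y t)).2) (inner ℝ w (rightNormal γ s)) (Ioi 0) 0 := by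
    have h1 := HasFDerivAt.comp_hasDerivWithinAt (0 : ℝ) hΨ hy
    have h2 := (hasFDerivAt_snd (𝕜 := ℝ) (p := Ψ (y 0))).comp_hasDerivWithinAt (0 : ℝ) h1
    rw [← frameEquiv_symm_apply_snd (hΩ.regular s)]
    exact h2
  have hyc : Tendsto y (𝓝[>] 0) (𝓝 (y 0)) := hy.continuousWithinAt
  have hr : ∀ᶠ t in 𝓝[>] (0 : ℝ), tubeMap γ (Ψ (y t)) = y t := by
    have h1 : ∀ᶠ z in 𝓝 (y 0), tubeMap γ (Ψ z) = z := by
      rw [← hγ]; exact hs.eventually_right_inverse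
    exact hyc.eventually h1
  have hsmall : ∀ᶠ t in 𝓝[>] (0 : ℝ), |(Ψ (y t)).2| < δ := by
    have h1 : Tendsto (fun t => |(Ψ (y t)).2|) (𝓝[>] 0) (𝓝 |(Ψ (y 0)).2|) :=
      hd.continuousWithinAt.tendsto.abs
    refine h1.eventually_lt_const ?_
    simpa [hΨ0] using hδ
  have hslope := (hasDerivWithinAt_iff_tendsto_slope' (by simp)).1 hd
  refine ⟨fun hneg => ?_, fun hpos => ?_⟩
  · filter_upwards [hr, hsmall, hslope.eventually_lt_const hneg, self_mem_nhdsWithin]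
      with t h1 h2 h3 ht
    rw [← h1]
    refine (H _ _ h2).1 ?_
    simp only [slope_def_field, hΨ0, sub_zero] at h3
    exact (div_neg_iff.1 h3).elim (fun h => absurd h.2 (not_lt.2 (le_of_lt ht))) fun h => h.1
  · filter_upwards [hr, hsmall, hslope.eventually_const_lt hpos, self_mem_nhdsWithin]
      with t h1 h2 h3 ht
    rw [← h1]
    refine (H _ _ h2).2 ?_
    simp only [slope_def_field, hΨ0, sub_zero] at h3
    exact (div_pos_iff.1 h3).elim (fun h => h.1) fun h => absurd h.2 (not_lt.2 (le_of_lt ht))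

end IsJordanRegion
/-! ### Change of variables from the coordinate plane -/

/-- The coordinates of the Euclidean plane. -/
noncomputable def planeCoord : Plane ≃L[ℝ] ℝ × ℝ :=
  (EuclideanSpace.equiv (Fin 2) ℝ).trans (ContinuousLinearEquiv.finTwoArrow ℝ ℝ)

theorem planeCoord_apply (x : Plane) : planeCoord x = (x 0, x 1) := rfl

theorem measurePreserving_planeCoord : MeasurePreserving planeCoord (volume : Measure Plane) volume :=
  (volume_preserving_finTwoArrow ℝ).comp
    (EuclideanSpace.volume_preserving_symm_measurableEquiv_toLp (Fin 2))

theorem measurableEmbedding_planeCoord : MeasurableEmbedding planeCoord :=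
  planeCoord.toHomeomorph.measurableEmbedding

section ChangeOfVariables

variable {φ : ℝ × ℝ → Plane} {φ' : ℝ × ℝ → (ℝ × ℝ) →L[ℝ] Plane} {A : Set (ℝ × ℝ)}

/-- Composition with the measure-preserving `planeCoord` makes `φ` a self-map of `ℝ × ℝ`, whose
derivative has a determinant. -/
theorem integral_image_plane (hA : MeasurableSet A)
    (hφ : ∀ p ∈ A, HasFDerivWithinAt φ (φ' p) A p) (hinj : InjOn φ A) (G : Plane → ℝ) :
    ∫ x in φ '' A, G x =
      ∫ p in A, |((planeCoord : Plane →L[ℝ] ℝ × ℝ).comp (φ' p)).det| * G (φ p) := by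
  have h := integral_image_eq_integral_abs_det_fderiv_smul volume hA
    (fun p hp => (planeCoord : Plane →L[ℝ] ℝ × ℝ).hasFDerivAt.comp_hasFDerivWithinAt p (hφ p hp))
    (planeCoord.injective.comp_injOn hinj) (fun q => G (planeCoord.symm q))
  rw [image_comp] at h
  erw [measurePreserving_planeCoord.setIntegral_image_emb measurableEmbedding_planeCoord] at h
  simpa using h

theorem integrableOn_image_plane (hA : MeasurableSet A)
    (hφ : ∀ p ∈ A, HasFDerivWithinAt φ (φ' p) A p) (hinj : InjOn φ A) (G : Plane → ℝ) :
    IntegrableOn G (φ '' A) ↔ IntegrableOn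
      (fun p => |((planeCoord : Plane →L[ℝ] ℝ × ℝ).comp (φ' p)).det| * G (φ p)) A := by
  have h := integrableOn_image_iff_integrableOn_abs_det_fderiv_smul volume hA
    (fun p hp => (planeCoord : Plane →L[ℝ] ℝ × ℝ).hasFDerivAt.comp_hasFDerivWithinAt p (hφ p hp))
    (planeCoord.injective.comp_injOn hinj) (fun q => G (planeCoord.symm q))
  rw [image_comp] at h
  erw [measurePreserving_planeCoord.integrableOn_image measurableEmbedding_planeCoord] at h
  simpa [Function.comp_def] using h

end ChangeOfVariables

/-! ### Rescaled normal coordinates and the integrals over them. -/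

theorem det_prod (L : (ℝ × ℝ) →L[ℝ] ℝ × ℝ) :
    L.det = (L (1, 0)).1 * (L (0, 1)).2 - (L (0, 1)).1 * (L (1, 0)).2 := by
  rw [ContinuousLinearMap.det, ← LinearMap.det_toMatrix (Module.Basis.finTwoProd ℝ),
    Matrix.det_fin_two]
  simp [LinearMap.toMatrix_apply]

/-- The Jacobian determinant of the normal coordinates. -/
noncomputable def tubeJacobian (γ : ℝ → Plane) (p : ℝ × ℝ) : ℝ :=
  ((planeCoord : Plane →L[ℝ] ℝ × ℝ).comp (fderiv ℝ (tubeMap γ) p)).det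

/-- The normal coordinates with the normal direction rescaled by `t`. -/
noncomputable def scaledTube (γ : ℝ → Plane) (t : ℝ) (p : ℝ × ℝ) : Plane :=
  tubeMap γ (p.1, t * p.2)

/-- A graph is a null set by Fubini. This discards `ρ = 0` and `ρ = v_n(s)`, where first-order
information does not decide the side of the curve. -/
theorem ae_snd_ne {h : ℝ → ℝ} (hh : Continuous h) : ∀ᵐ p : ℝ × ℝ, p.2 ≠ h p.1 := by
  rw [ae_iff, Measure.volume_eq_prod, Measure.measure_prod_null]
  · refine Eventually.of_forall fun x => ?_
    have : Prod.mk x ⁻¹' {p : ℝ × ℝ | ¬p.2 ≠ h p.1} = {h x} := by ext y; simp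
    simp only [this, Real.volume_singleton, Pi.zero_apply]
  · simpa using (isClosed_eq continuous_snd (hh.comp continuous_fst)).measurableSet

/-- Each indicator of `Iio w` integrates to `w + C`, whatever the sign of `w`, and the constants
cancel. This is where the normal velocity enters the transport formula. -/
theorem integral_lt_sub_lt {C v : ℝ} (hv : |v| ≤ C) :
    ∫ ρ in Icc (-C) C, ((Iio v).indicator 1 ρ - (Iio 0).indicator 1 ρ : ℝ) = v := by
  have key : ∀ w : ℝ, |w| ≤ C → IntegrableOn ((Iio w).indicator (1 : ℝ → ℝ)) (Icc (-C) C) ∧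
      ∫ ρ in Icc (-C) C, (Iio w).indicator (1 : ℝ → ℝ) ρ = w + C := by
    intro w hw
    have hw' := abs_le.1 hw
    refine ⟨(integrable_const (1 : ℝ)).indicator measurableSet_Iio, ?_⟩
    rw [setIntegral_indicator measurableSet_Iio]
    have : Icc (-C) C ∩ Iio w = Ico (-C) w := by
      ext x; simp only [mem_inter_iff, mem_Icc, mem_Iio, mem_Ico]
      exact ⟨fun h => ⟨h.1.1, h.2⟩, fun h => ⟨⟨h.1, h.2.le.trans hw'.2⟩, h.2⟩⟩
    rw [this]
    simp only [Pi.one_apply, integral_const, MeasurableSet.univ, measureReal_restrict_apply,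
      univ_inter, smul_eq_mul, mul_one]
    rw [Real.volume_real_Ico_of_le hw'.1]; ring
  have h0 := key 0 (by simpa using (abs_nonneg v).trans hv)
  rw [integral_sub (key v hv).1 h0.1, (key v hv).2, h0.2]; ring

/-- Continuity at the points of `K` gives local bounds, which compactness patches together. It
supplies the domination near `Γ` for an integrand that may be unbounded elsewhere. -/
theorem _root_.IsCompact.exists_bound_nhdsSet {X : Type*} [TopologicalSpace X] {K D : Set X}
    (hK : IsCompact K) {g : X → ℝ} (hg : ∀ x ∈ K, ContinuousWithinAt g D x) :
    ∃ M, ∀ᶠ x in 𝓝ˢ K, x ∈ D → |g x| ≤ M := by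
  refine hK.induction_on (p := fun S => ∃ M, ∀ᶠ x in 𝓝ˢ S, x ∈ D → |g x| ≤ M) ⟨0, by simp⟩ ?_ ?_ ?_
  · rintro S S' hSS ⟨M, hM⟩
    exact ⟨M, hM.filter_mono (nhdsSet_mono hSS)⟩
  · rintro S S' ⟨M, hM⟩ ⟨M', hM'⟩
    refine ⟨max M M', ?_⟩
    rw [nhdsSet_union, eventually_sup]
    exact ⟨hM.mono fun x hx h => (hx h).trans (le_max_left _ _),
      hM'.mono fun x hx h => (hx h).trans (le_max_right _ _)⟩
  · intro x hx
    have h1 : ∀ᶠ y in 𝓝[D] x, |g y| ≤ |g x| + 1 :=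
      ((hg x hx).abs.eventually_lt_const (lt_add_one _)).mono fun _ h => h.le
    rw [eventually_nhdsWithin_iff] at h1
    obtain ⟨U, hU, hUo, hxU⟩ := eventually_nhds_iff.1 h1
    exact ⟨U, mem_nhdsWithin_of_mem_nhds (hUo.mem_nhds hxU), |g x| + 1,
      (eventually_nhdsSet_iff_forall).2 fun y hy => (hUo.mem_nhds hy : U ∈ 𝓝 y) |> fun h =>
        mem_of_superset h hU⟩

namespace IsJordanRegion

variable {Ω : Set Plane} {γ : ℝ → Plane} {ℓ : ℝ}

theorem continuous_tubeJacobian (hΩ : IsJordanRegion Ω γ ℓ) : Continuous (tubeJacobian γ) :=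
  ContinuousLinearMap.continuous_det.comp
    (continuous_const.clm_comp (hΩ.contDiff_tubeMap.continuous_fderiv one_ne_zero))

theorem abs_tubeJacobian_zero (hΩ : IsJordanRegion Ω γ ℓ) (s : ℝ) :
    |tubeJacobian γ (s, 0)| = ‖deriv γ s‖ := by
  have h0 := hΩ.norm_deriv_pos s
  -- The frame of tangent and right normal is negatively oriented.
  have : tubeJacobian γ (s, 0) = -‖deriv γ s‖ := by
    rw [tubeJacobian, hΩ.fderiv_tubeMap_zero, det_prod]
    simp [frameEquiv_apply, planeCoord_apply]
    field_simp
    rw [norm_sq_plane]; ring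
  rw [this, abs_neg, abs_of_pos h0]

theorem hasFDerivAt_scaledTube (hΩ : IsJordanRegion Ω γ ℓ) (t : ℝ) (p : ℝ × ℝ) :
    HasFDerivAt (scaledTube γ t) ((fderiv ℝ (tubeMap γ) (p.1, t * p.2)).comp
      ((ContinuousLinearMap.id ℝ ℝ).prodMap (t • ContinuousLinearMap.id ℝ ℝ))) p :=
  HasFDerivAt.comp (g := tubeMap γ) p
    (hΩ.contDiff_tubeMap.differentiable one_ne_zero _).hasFDerivAt
    (((ContinuousLinearMap.id ℝ ℝ).prodMap (t • ContinuousLinearMap.id ℝ ℝ)).hasFDerivAt)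

/-- The rescaling multiplies the normal column by `t`; this factor cancels the denominator of the
difference quotient. -/
theorem det_fderiv_scaledTube (γ : ℝ → Plane) (t : ℝ) (p : ℝ × ℝ) :
    ((planeCoord : Plane →L[ℝ] ℝ × ℝ).comp ((fderiv ℝ (tubeMap γ) (p.1, t * p.2)).comp
      ((ContinuousLinearMap.id ℝ ℝ).prodMap (t • ContinuousLinearMap.id ℝ ℝ)))).det =
      t * tubeJacobian γ (p.1, t * p.2) := by
  have h1 : ((ContinuousLinearMap.id ℝ ℝ).prodMap (t • ContinuousLinearMap.id ℝ ℝ)) (1, 0)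
      = ((1, 0) : ℝ × ℝ) := by simp
  have h2 : ((ContinuousLinearMap.id ℝ ℝ).prodMap (t • ContinuousLinearMap.id ℝ ℝ)) (0, 1)
      = t • ((0, 1) : ℝ × ℝ) := by simp
  rw [tubeJacobian, det_prod, det_prod]
  simp only [ContinuousLinearMap.comp_apply, h1, h2, map_smul, Prod.smul_fst, Prod.smul_snd,
    smul_eq_mul]
  ring

end IsJordanRegion
/-! ### Differentiation of domain integrals -/

section Transport

variable {D Ω : Set Plane} {γ : ℝ → Plane} {ℓ : ℝ} {T : ℝ → Plane ≃ Plane} {ε : ℝ} {g : Plane → ℝ}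

theorem IsDeformation.isOpen_image (hT : IsDeformation T ε) (hU : IsOpen Ω) {t : ℝ}
    (ht : t ∈ Ico 0 ε) : IsOpen (T t '' Ω) := by
  rw [Equiv.image_eq_preimage_symm]
  exact hU.preimage (hT.contDiff_symm t ht).continuous

theorem IsDeformation.image_zero (hT : IsDeformation T ε) (S : Set Plane) : T 0 '' S = S := by
  have : (T 0 : Plane → Plane) = id := funext hT.zero
  rw [this, image_id]

theorem IsDeformation.subset (hT : IsDeformation T ε) (hTD : ∀ t ∈ Ico 0 ε, T t '' Ω ⊆ D) :
    Ω ⊆ D := by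
  simpa [hT.image_zero] using hTD 0 hT.zero_mem

theorem IsJordanRegion.curve_mem_closure (hΩ : IsJordanRegion Ω γ ℓ) (s : ℝ) : γ s ∈ closure Ω :=
  frontier_subset_closure (hΩ.frontier_eq ▸ mem_range_self s)

theorem IsJordanRegion.curve_mem (hΩ : IsJordanRegion Ω γ ℓ) (hD : IsClosed D) (hΩD : Ω ⊆ D)
    (s : ℝ) : γ s ∈ D := hD.closure_subset_iff.2 hΩD (hΩ.curve_mem_closure s)

theorem IsJordanRegion.continuous_comp (hΩ : IsJordanRegion Ω γ ℓ) (hD : IsClosed D) (hΩD : Ω ⊆ D)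
    (hg : ∀ x ∈ frontier Ω, ContinuousWithinAt g D x) : Continuous fun s => g (γ s) := by
  rw [continuous_iff_continuousAt]
  intro s
  have h := hg (γ s) (hΩ.frontier_eq ▸ mem_range_self s)
  exact h.tendsto.comp (tendsto_nhdsWithin_iff.2
    ⟨hΩ.continuous_curve.tendsto s, Eventually.of_forall (hΩ.curve_mem hD hΩD)⟩)

theorem normalVelocity_eq (hT : IsDeformation T ε) (γ : ℝ → Plane) (s : ℝ) :
    normalVelocity T ε γ s = inner ℝ (lagrangianVelocity T ε 0 (γ s)) (rightNormal γ s) := by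
  rw [normalVelocity, hT.eulerianVelocity_zero]

theorem continuous_normalVelocity (hΩ : IsJordanRegion Ω γ ℓ) (hT : IsDeformation T ε) :
    Continuous (normalVelocity T ε γ) := by
  rw [funext (normalVelocity_eq hT γ)]
  exact (hT.contDiff_velocity_zero.continuous.comp hΩ.continuous_curve).inner
    hΩ.contDiff_rightNormal.continuous

/-- The difference of the integrands over the deformed and the original region. -/
noncomputable def indicatorDiff (T : ℝ → Plane ≃ Plane) (Ω : Set Plane) (g : Plane → ℝ) (t : ℝ)
    (x : Plane) : ℝ := (T t '' Ω).indicator g x - Ω.indicator g x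

/-- The point `γ(s) + tρ n(s)` leaves the curve with normal velocity `ρ`, and its preimage under
`T_t` with normal velocity `ρ - v_n(s)`. When both are nonzero, their signs decide membership in `Ω`
and in `T_t Ω` for small `t`. -/
theorem tendsto_indicatorDiff (hΩ : IsJordanRegion Ω γ ℓ) (hT : IsDeformation T ε)
    (hTD : ∀ t ∈ Ico 0 ε, T t '' Ω ⊆ D) (hg : ∀ x ∈ frontier Ω, ContinuousWithinAt g D x)
    {s ρ : ℝ} (hρ0 : ρ ≠ 0) (hρv : ρ ≠ normalVelocity T ε γ s) :
    Tendsto (fun t => indicatorDiff T Ω g t (scaledTube γ t (s, ρ))) (𝓝[>] 0)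
      (𝓝 (((Iio (normalVelocity T ε γ s)).indicator 1 ρ - (Iio 0).indicator 1 ρ) * g (γ s))) := by
  set x : ℝ → Plane := fun t => scaledTube γ t (s, ρ)
  set v := normalVelocity T ε γ s
  have hx : HasDerivWithinAt x (ρ • rightNormal γ s) (Ioi 0) 0 := by
    have h1 := (((hasDerivWithinAt_id (0 : ℝ) (Ioi 0)).mul_const ρ).smul_const
      (rightNormal γ s)).const_add (γ s)
    simpa [x, scaledTube, tubeMap] using h1
  have hx0 : x 0 = γ s := by simp [x, scaledTube]
  have hy := hT.hasDerivWithinAt_symm hx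
  have hyv : inner ℝ (ρ • rightNormal γ s - lagrangianVelocity T ε 0 (x 0)) (rightNormal γ s)
      = ρ - v := by
    rw [inner_sub_left, inner_smul_left, inner_rightNormal_self (hΩ.regular s), hx0,
      ← normalVelocity_eq hT]
    simp [v]
  have hxv : inner ℝ (ρ • rightNormal γ s) (rightNormal γ s) = ρ := by
    rw [inner_smul_left, inner_rightNormal_self (hΩ.regular s)]; simp
  have hΩx := hΩ.eventually_mem_or_notMem hx hx0
  have hΩy := hΩ.eventually_mem_or_notMem (s := s) hy (by simp [hT.symm_zero, hx0])
  rw [hxv] at hΩx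
  rw [hyv] at hΩy
  have hmem : ∀ t, x t ∈ T t '' Ω ↔ (T t).symm (x t) ∈ Ω := fun t => by
    rw [Equiv.image_eq_preimage_symm]; rfl
  simp only [← hmem] at hΩy
  -- Continuity of `g` holds relative to `D` only. In the two cases where `g` survives, the point
  -- lies in `T_t Ω` or in `Ω`, hence in `D`.
  have hgx : (∀ᶠ t in 𝓝[>] (0 : ℝ), x t ∈ D) →
      Tendsto (fun t => g (x t)) (𝓝[>] 0) (𝓝 (g (γ s))) := by
    intro hxD
    have hxc : Tendsto x (𝓝[>] 0) (𝓝 (γ s)) := hx0 ▸ hx.continuousWithinAt.tendsto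
    exact (hg (γ s) (hΩ.frontier_eq ▸ mem_range_self s)).tendsto.comp
      (tendsto_nhdsWithin_iff.2 ⟨hxc, hxD⟩)
  have hIco : ∀ᶠ t in 𝓝[>] (0 : ℝ), t ∈ Ico 0 ε :=
    mem_of_superset (Ioo_mem_nhdsGT hT.pos) Ioo_subset_Ico_self
  rcases lt_or_gt_of_ne hρv with h1 | h1 <;> rcases lt_or_gt_of_ne hρ0 with h2 | h2
  · have e1 := hΩy.1 (by linarith)
    have e2 := hΩx.1 h2
    rw [indicator_of_mem (show ρ ∈ Iio v from h1), indicator_of_mem (show ρ ∈ Iio 0 from h2)]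
    rw [sub_self, zero_mul]
    refine tendsto_const_nhds.congr' ?_
    filter_upwards [e1, e2] with t h3 h4
    simp [indicatorDiff, x, indicator_of_mem h3, indicator_of_mem h4]
  · have e1 := hΩy.1 (by linarith)
    have e2 := hΩx.2 h2
    rw [indicator_of_mem (show ρ ∈ Iio v from h1),
      indicator_of_notMem (show ρ ∉ Iio 0 from not_lt.2 (le_of_lt h2))]
    rw [Pi.one_apply, sub_zero, one_mul]
    refine (hgx ?_).congr' ?_
    · filter_upwards [e1, hIco] with t h3 h4 using hTD t h4 h3
    · filter_upwards [e1, e2] with t h3 h4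
      simp [indicatorDiff, x, indicator_of_mem h3, indicator_of_notMem h4]
  · have e1 := hΩy.2 (by linarith)
    have e2 := hΩx.1 h2
    rw [indicator_of_notMem (show ρ ∉ Iio v from not_lt.2 (le_of_lt h1)),
      indicator_of_mem (show ρ ∈ Iio 0 from h2)]
    rw [Pi.one_apply, zero_sub, neg_one_mul]
    refine (hgx ?_).neg.congr' ?_
    · filter_upwards [e2] with t h3 using hT.subset hTD h3
    · filter_upwards [e1, e2] with t h3 h4
      simp [indicatorDiff, x, indicator_of_notMem h3, indicator_of_mem h4]
  · have e1 := hΩy.2 (by linarith)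
    have e2 := hΩx.2 h2
    rw [indicator_of_notMem (show ρ ∉ Iio v from not_lt.2 (le_of_lt h1)),
      indicator_of_notMem (show ρ ∉ Iio 0 from not_lt.2 (le_of_lt h2))]
    rw [sub_self, zero_mul]
    refine tendsto_const_nhds.congr' ?_
    filter_upwards [e1, e2] with t h3 h4
    simp [indicatorDiff, x, indicator_of_notMem h3, indicator_of_notMem h4]

/-- The region changes only within a tube whose width is proportional to the time. -/
theorem exists_indicatorDiff_eq_zero (hΩ : IsJordanRegion Ω γ ℓ) (hT : IsDeformation T ε)
    (g : Plane → ℝ) : ∃ C > 0, ∀ᶠ t in 𝓝[>] (0 : ℝ), ∀ C' ≥ C,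
      ∀ x ∉ scaledTube γ t '' (Ioc 0 ℓ ×ˢ Icc (-C') C'), indicatorDiff T Ω g t x = 0 := by
  obtain ⟨R, hR⟩ := hΩ.isBounded.subset_closedBall (0 : Plane)
  obtain ⟨C, hC, t₀, ht₀, H⟩ := hT.exists_norm_symm_sub_le R
  refine ⟨C, hC, ?_⟩
  filter_upwards [Ioc_mem_nhdsGT ht₀.1] with t ht C' hC' x hx
  have ht' : t ∈ Icc 0 t₀ := ⟨ht.1.le, ht.2⟩
  -- A point within `C * t` of the curve has normal coordinates with `|r| ≤ C * t`, so it would lie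
  -- in the rescaled tube. Being farther away, `x` cannot be separated from its preimage or its
  -- image by the frontier, as these are within `C * t` of it.
  have hfar : C * t < Metric.infDist x (frontier Ω) := by
    by_contra! h
    rw [hΩ.frontier_eq] at h
    obtain ⟨s, hs, r, hr, rfl⟩ := hΩ.exists_eq_tubeMap x
    refine hx ⟨(s, r / t), ⟨hs, ?_⟩, ?_⟩
    · rw [← hr] at h
      rw [mem_Icc, ← abs_le, abs_div, abs_of_pos ht.1, div_le_iff₀ ht.1]
      exact h.trans (mul_le_mul_of_nonneg_right hC' ht.1.le)
    · simp [scaledTube, mul_div_cancel₀ _ ht.1.ne']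
  have hiff : x ∈ T t '' Ω ↔ x ∈ Ω := by
    rw [Equiv.image_eq_preimage_symm, mem_preimage]
    constructor
    · intro h
      by_contra hxΩ
      have h1 := infDist_frontier_le hΩ.isOpen h hxΩ x (Or.inr rfl)
      have h2 := (H t ht').1 _ (hR h)
      rw [Equiv.apply_symm_apply, norm_sub_rev] at h2
      linarith
    · intro hxΩ
      by_contra h
      have h1 := infDist_frontier_le hΩ.isOpen hxΩ h x (Or.inl rfl)
      have h2 := ((H t ht').2 _ (hR hxΩ)).2
      rw [norm_sub_rev] at h2
      linarith
  by_cases h : x ∈ Ω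
  · rw [indicatorDiff, indicator_of_mem h, indicator_of_mem (hiff.2 h), sub_self]
  · rw [indicatorDiff, indicator_of_notMem h, indicator_of_notMem (mt hiff.1 h), sub_self]

theorem injOn_scaledTube {δ C t : ℝ}
    (hδ : InjOn (tubeMap γ) (Ioc 0 ℓ ×ˢ Ioo (-δ) δ)) (ht : 0 < t) (hCt : C * t < δ) :
    InjOn (scaledTube γ t) (Ioc 0 ℓ ×ˢ Icc (-C) C) := by
  have hm : ∀ p ∈ Ioc 0 ℓ ×ˢ Icc (-C) C, ((p.1, t * p.2) : ℝ × ℝ) ∈ Ioc 0 ℓ ×ˢ Ioo (-δ) δ := by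
    rintro ⟨s, r⟩ ⟨hs, hr⟩
    refine ⟨hs, ?_, ?_⟩
    · have := mul_le_mul_of_nonneg_left hr.1 ht.le
      simp only at this ⊢; linarith
    · have := mul_le_mul_of_nonneg_left hr.2 ht.le
      simp only at this ⊢; linarith
  intro p hp q hq hpq
  have h := hδ (hm p hp) (hm q hq) hpq
  rw [Prod.mk.injEq, mul_right_inj' ht.ne'] at h
  exact Prod.ext h.1 h.2

/-- For small `t` the tube lies in a neighbourhood of the curve where `g` is bounded on `D`; both
regions are contained in `D`, so the indicators remove all other values. -/
theorem exists_norm_indicatorDiff_le (hΩ : IsJordanRegion Ω γ ℓ) (hT : IsDeformation T ε)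
    (hTD : ∀ t ∈ Ico 0 ε, T t '' Ω ⊆ D) (hg : ∀ x ∈ frontier Ω, ContinuousWithinAt g D x)
    {C : ℝ} (hC : 0 < C) :
    ∃ M, ∀ᶠ t in 𝓝[>] (0 : ℝ), ∀ s, ∀ ρ ∈ Icc (-C) C,
      |indicatorDiff T Ω g t (scaledTube γ t (s, ρ))| ≤ M := by
  rw [hΩ.frontier_eq] at hg
  obtain ⟨M, hM⟩ := hΩ.isCompact_range.exists_bound_nhdsSet hg
  obtain ⟨U, hU, hUM⟩ := mem_nhdsSet_iff_exists.1 hM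
  obtain ⟨δ, hδ, hth⟩ := hΩ.isCompact_range.exists_thickening_subset_open hU hUM.1
  refine ⟨|M| + |M|, ?_⟩
  filter_upwards [Ioo_mem_nhdsGT (show 0 < δ / C by positivity), Ioo_mem_nhdsGT hT.pos]
    with t ht htε s ρ hρ
  set x := scaledTube γ t (s, ρ)
  have hx : x ∈ U := by
    refine hth (Metric.mem_thickening_iff.2 ⟨γ s, mem_range_self s, ?_⟩)
    have h1 : x - γ s = (t * ρ) • rightNormal γ s := by simp [x, scaledTube, tubeMap]
    rw [dist_eq_norm, h1, norm_smul, norm_rightNormal (hΩ.regular s), mul_one, Real.norm_eq_abs,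
      abs_mul, abs_of_pos ht.1]
    have h2 := ht.2
    rw [lt_div_iff₀ hC] at h2
    exact (mul_le_mul_of_nonneg_left (abs_le.2 hρ) ht.1.le).trans_lt h2
  have hb : ∀ S ⊆ D, |S.indicator g x| ≤ |M| := by
    intro S hS
    by_cases h : x ∈ S
    · rw [indicator_of_mem h]; exact (hUM.2 hx (hS h)).trans (le_abs_self _)
    · rw [indicator_of_notMem h, abs_zero]; positivity
  exact (abs_sub _ _).trans
    (add_le_add (hb _ (hTD t (Ioo_subset_Ico_self htε))) (hb _ (hT.subset hTD)))

theorem integral_tube_eq_intervalIntegral {h v : ℝ → ℝ} (hℓ : 0 < ℓ) (hh : Continuous h)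
    (hv : Continuous v) {C : ℝ} (hC : ∀ s ∈ Ioc 0 ℓ, |v s| ≤ C) :
    ∫ p in Ioc 0 ℓ ×ˢ Icc (-C) C,
      h p.1 * ((Iio (v p.1)).indicator 1 p.2 - (Iio 0).indicator 1 p.2) =
      ∫ s in (0 : ℝ)..ℓ, h s * v s := by
  have hm : Measurable fun p : ℝ × ℝ =>
      ((Iio (v p.1)).indicator 1 p.2 - (Iio 0).indicator 1 p.2 : ℝ) := by
    have h1 : Measurable fun p : ℝ × ℝ => ((Iio (v p.1)).indicator 1 p.2 : ℝ) := by
      have : (fun p : ℝ × ℝ => ((Iio (v p.1)).indicator 1 p.2 : ℝ)) =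
          {p : ℝ × ℝ | p.2 < v p.1}.indicator 1 := by
        ext p; simp [indicator]
      rw [this]
      exact measurable_one.indicator
        (measurableSet_lt measurable_snd (hv.measurable.comp measurable_fst))
    exact h1.sub ((measurable_one.indicator measurableSet_Iio).comp measurable_snd)
  have hint : IntegrableOn (fun p : ℝ × ℝ =>
      h p.1 * ((Iio (v p.1)).indicator 1 p.2 - (Iio 0).indicator 1 p.2)) (Ioc 0 ℓ ×ˢ Icc (-C) C) := by
    have h1 : IntegrableOn (fun p : ℝ × ℝ => h p.1) (Ioc 0 ℓ ×ˢ Icc (-C) C) :=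
      ((hh.comp continuous_fst).continuousOn.integrableOn_compact
        (isCompact_Icc.prod isCompact_Icc)).mono_set
        (prod_mono (Ioc_subset_Icc_self (a := 0) (b := ℓ)) subset_rfl)
    refine h1.mul_bdd (c := 2) hm.aestronglyMeasurable (Eventually.of_forall fun p => ?_)
    refine (norm_sub_le _ _).trans ?_
    have : ∀ (S : Set ℝ) (x : ℝ), ‖S.indicator (1 : ℝ → ℝ) x‖ ≤ 1 := fun S x => by
      simpa using norm_indicator_le_norm_self (s := S) (1 : ℝ → ℝ) x
    linarith [this (Iio (v p.1)) p.2, this (Iio 0) p.2]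
  rw [Measure.volume_eq_prod] at hint ⊢
  rw [setIntegral_prod _ hint, intervalIntegral.integral_of_le hℓ.le]
  refine setIntegral_congr_fun measurableSet_Ioc fun s hs => ?_
  simp only
  rw [integral_const_mul, integral_lt_sub_lt (hC s hs)]

/-- **Transport theorem**: the derivative of the integral of `g` over the deformed region is the
boundary integral of `g` times the normal velocity. -/
theorem hasDerivWithinAt_setIntegral (hD : IsClosed D) (hΩ : IsJordanRegion Ω γ ℓ)
    (hT : IsDeformation T ε) (hTD : ∀ t ∈ Ico 0 ε, T t '' Ω ⊆ D) (hgD : IntegrableOn g D)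
    (hg : ∀ x ∈ frontier Ω, ContinuousWithinAt g D x) :
    HasDerivWithinAt (fun t => ∫ x in T t '' Ω, g x)
      (arcIntegral γ ℓ fun s => g (γ s) * normalVelocity T ε γ s) (Ioi 0) 0 := by
  set v := normalVelocity T ε γ
  have hv : Continuous v := continuous_normalVelocity hΩ hT
  obtain ⟨V, hV⟩ := isCompact_Icc.exists_bound_of_continuousOn (s := Icc 0 ℓ) hv.continuousOn
  obtain ⟨C₀, hC₀, hzero⟩ := exists_indicatorDiff_eq_zero hΩ hT g
  obtain ⟨δ, hδ, hinj, -⟩ := hΩ.exists_tube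
  -- The summand `C₀` makes the tube contain the change of the region, and `|V|` makes it contain
  -- the graph of the normal velocity.
  set C := C₀ + |V|
  have hC : 0 < C := by positivity
  have hvC : ∀ s ∈ Ioc 0 ℓ, |v s| ≤ C := fun s hs =>
    ((hV s (Ioc_subset_Icc_self hs)).trans (le_abs_self V)).trans (by simp only [C]; linarith)
  obtain ⟨M, hM⟩ := exists_norm_indicatorDiff_le hΩ hT hTD hg hC
  set A : Set (ℝ × ℝ) := Ioc 0 ℓ ×ˢ Icc (-C) C
  have hA : MeasurableSet A := measurableSet_Ioc.prod measurableSet_Icc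
  have hAfin : volume A ≠ ⊤ :=
    ((measure_mono (prod_mono Ioc_subset_Icc_self subset_rfl)).trans_lt
      ((isCompact_Icc (a := (0 : ℝ)) (b := ℓ)).prod isCompact_Icc).measure_lt_top).ne
  obtain ⟨B, hB⟩ := ((isCompact_Icc (a := (0 : ℝ)) (b := ℓ)).prod
    (isCompact_Icc (a := -C) (b := C))).exists_bound_of_continuousOn
    hΩ.continuous_tubeJacobian.continuousOn
  have hev : ∀ᶠ t in 𝓝[>] (0 : ℝ), 0 < t ∧ t < 1 ∧ t ∈ Ico 0 ε ∧ C * t < δ := by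
    filter_upwards [Ioo_mem_nhdsGT one_pos, Ioo_mem_nhdsGT hT.pos,
      Ioo_mem_nhdsGT (show 0 < δ / C by positivity)] with t h1 h2 h3
    refine ⟨h1.1, h1.2, Ioo_subset_Ico_self h2, ?_⟩
    have := h3.2
    rw [lt_div_iff₀ hC] at this; linarith
  have hdiff : ∀ t ∈ Ico 0 ε, Integrable (indicatorDiff T Ω g t) ∧
      ∫ x, indicatorDiff T Ω g t x = (∫ x in T t '' Ω, g x) - ∫ x in Ω, g x := by
    intro t ht
    have m1 := (hT.isOpen_image hΩ.isOpen ht).measurableSet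
    have i1 : Integrable ((T t '' Ω).indicator g) :=
      (integrable_indicator_iff m1).2 (hgD.mono_set (hTD t ht))
    have i2 : Integrable (Ω.indicator g) :=
      (integrable_indicator_iff hΩ.isOpen.measurableSet).2 (hgD.mono_set (hT.subset hTD))
    refine ⟨i1.sub i2, ?_⟩
    simp only [indicatorDiff]
    rw [integral_sub i1 i2, integral_indicator m1, integral_indicator hΩ.isOpen.measurableSet]
  let F : ℝ → ℝ × ℝ → ℝ := fun t p =>
    |tubeJacobian γ (p.1, t * p.2)| * indicatorDiff T Ω g t (scaledTube γ t p)
  have hcov : ∀ t, 0 < t → C * t < δ → t ∈ Ico 0 ε → (∀ C' ≥ C₀,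
      ∀ x ∉ scaledTube γ t '' (Ioc 0 ℓ ×ˢ Icc (-C') C'), indicatorDiff T Ω g t x = 0) →
      IntegrableOn (F t) A ∧
        t⁻¹ * ((∫ x in T t '' Ω, g x) - ∫ x in Ω, g x) = ∫ p in A, F t p := by
    intro t ht hCt htε hz
    have hder : ∀ p ∈ A, HasFDerivWithinAt (scaledTube γ t) _ A p := fun p _ =>
      (hΩ.hasFDerivAt_scaledTube t p).hasFDerivWithinAt
    have hi := injOn_scaledTube hinj ht hCt
    have hfun : (fun p : ℝ × ℝ => t * F t p) = fun p =>
        |((planeCoord : Plane →L[ℝ] ℝ × ℝ).comp ((fderiv ℝ (tubeMap γ) (p.1, t * p.2)).comp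
          ((ContinuousLinearMap.id ℝ ℝ).prodMap (t • ContinuousLinearMap.id ℝ ℝ)))).det|
          * indicatorDiff T Ω g t (scaledTube γ t p) := by
      ext p
      rw [IsJordanRegion.det_fderiv_scaledTube, abs_mul, abs_of_pos ht, mul_assoc]
    have h1 := (integrableOn_image_plane hA hder hi (indicatorDiff T Ω g t)).1
      (hdiff t htε).1.integrableOn
    have h2 := integral_image_plane hA hder hi (indicatorDiff T Ω g t)
    rw [← hfun] at h1
    rw [setIntegral_eq_integral_of_forall_compl_eq_zero
      (hz C (by simp only [C]; linarith [abs_nonneg V])), (hdiff t htε).2] at h2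
    have h3 := congrArg (fun f : ℝ × ℝ → ℝ => ∫ p in A, f p) hfun
    simp only at h3
    rw [← h3, integral_const_mul] at h2
    refine ⟨?_, by rw [h2, inv_mul_cancel_left₀ ht.ne']⟩
    have h4 := h1.const_mul t⁻¹
    simp only [inv_mul_cancel_left₀ ht.ne'] at h4
    exact h4
  rw [hasDerivWithinAt_iff_tendsto_slope' (by simp)]
  have hlim : Tendsto (fun t => ∫ p in A, F t p) (𝓝[>] 0)
      (𝓝 (∫ p in A, (g (γ p.1) * ‖deriv γ p.1‖) *
        ((Iio (v p.1)).indicator 1 p.2 - (Iio 0).indicator 1 p.2))) := by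
    -- For `t < 1` the point `(s, tρ)` stays in the compact rectangle on which `B` bounds the
    -- Jacobian.
    refine tendsto_integral_filter_of_dominated_convergence (fun _ => |B| * M) ?_ ?_ ?_ ?_
    · filter_upwards [hev, hzero] with t ht hz
      exact (hcov t ht.1 ht.2.2.2 ht.2.2.1 hz).1.aestronglyMeasurable
    · filter_upwards [hev, hM] with t ht hMt
      refine ae_restrict_of_forall_mem hA fun p hp => ?_
      rw [norm_mul, Real.norm_eq_abs, Real.norm_eq_abs, abs_abs]
      refine mul_le_mul ?_ (hMt p.1 p.2 hp.2) (abs_nonneg _) (abs_nonneg _)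
      refine (hB (p.1, t * p.2) ⟨Ioc_subset_Icc_self hp.1, ?_⟩).trans (le_abs_self _)
      rw [mem_Icc, ← abs_le, abs_mul, abs_of_pos ht.1]
      exact (mul_le_of_le_one_left (abs_nonneg _) ht.2.1.le).trans (abs_le.2 hp.2)
    · exact integrableOn_const hAfin
    · filter_upwards [ae_restrict_of_ae (ae_snd_ne hv),
        ae_restrict_of_ae (ae_snd_ne (continuous_const (y := (0 : ℝ))))] with p h1 h2
      have hJ : Tendsto (fun t => |tubeJacobian γ (p.1, t * p.2)|) (𝓝[>] 0)
          (𝓝 ‖deriv γ p.1‖) := by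
        rw [← hΩ.abs_tubeJacobian_zero]
        have hc : Continuous fun t : ℝ => |tubeJacobian γ (p.1, t * p.2)| :=
          (hΩ.continuous_tubeJacobian.comp (by fun_prop)).abs
        have := hc.tendsto 0
        rw [zero_mul] at this
        exact this.mono_left nhdsWithin_le_nhds
      have := hJ.mul (tendsto_indicatorDiff hΩ hT hTD hg h2 h1)
      convert this using 2
      ring
  rw [integral_tube_eq_intervalIntegral (h := fun s => g (γ s) * ‖deriv γ s‖) hΩ.period_pos
    ((hΩ.continuous_comp hD (hT.subset hTD) hg).mul hΩ.contDiff_norm_deriv.continuous) hv hvC]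
    at hlim
  have harc : (arcIntegral γ ℓ fun s => g (γ s) * v s) =
      ∫ s in (0 : ℝ)..ℓ, g (γ s) * ‖deriv γ s‖ * v s := by
    rw [arcIntegral]; congr 1; ext s; ring
  rw [harc]
  refine hlim.congr' ?_
  filter_upwards [hev, hzero] with t ht hz
  rw [slope_def_module, sub_zero, hT.image_zero, smul_eq_mul]
  exact (hcov t ht.1 ht.2.2.2 ht.2.2.1 hz).2.symm

end Transport
/-! ### The length of a simple closed curve -/

section Length

open scoped NNReal ENNReal

variable {c : ℝ → Plane} {ℓ : ℝ}

theorem hausdorffMeasure_image_le_of_norm_sub_le {I : Set ℝ} {K : ℝ} (hK : 0 ≤ K)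
    (h : ∀ x ∈ I, ∀ y ∈ I, ‖c x - c y‖ ≤ K * |x - y|) :
    (Measure.hausdorffMeasure 1 : Measure Plane) (c '' I) ≤ ENNReal.ofReal K * volume I := by
  have hl : LipschitzOnWith (NNReal.mk K hK) c I := LipschitzOnWith.of_dist_le_mul fun x hx y hy => by
    rw [dist_eq_norm, Real.dist_eq]; exact h x hx y hy
  have := hl.hausdorffMeasure_image_le (d := 1) zero_le_one
  rw [hausdorffMeasure_real, ENNReal.rpow_one] at this
  rwa [ENNReal.ofReal, Real.toNNReal_of_nonneg hK]

/-- The inverse of `c` on the image is Lipschitz with constant `K⁻¹`, so the upper estimate for it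
gives the lower one for `c`. -/
theorem le_hausdorffMeasure_image_of_le_norm_sub {I : Set ℝ} {K : ℝ} (hK : 0 < K)
    (h : ∀ x ∈ I, ∀ y ∈ I, K * |x - y| ≤ ‖c x - c y‖) :
    ENNReal.ofReal K * volume I ≤ (Measure.hausdorffMeasure 1 : Measure Plane) (c '' I) := by
  have hinj : InjOn c I := fun x hx y hy hxy => by
    have h1 := h x hx y hy
    rw [hxy, sub_self, norm_zero] at h1
    have h2 : |x - y| ≤ 0 := by
      by_contra! h3
      exact absurd h1 (not_le.2 (mul_pos hK h3))
    exact sub_eq_zero.1 (abs_nonpos_iff.1 h2)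
  have hinv := hinj.leftInvOn_invFunOn
  have hl : LipschitzOnWith (NNReal.mk K⁻¹ (inv_pos.2 hK).le) (Function.invFunOn c I) (c '' I) := by
    refine LipschitzOnWith.of_dist_le_mul ?_
    rintro _ ⟨x, hx, rfl⟩ _ ⟨y, hy, rfl⟩
    rw [hinv hx, hinv hy, dist_eq_norm (c x), Real.dist_eq]
    have := h x hx y hy
    change |x - y| ≤ K⁻¹ * _
    rwa [le_inv_mul_iff₀ hK]
  have := hl.hausdorffMeasure_image_le (d := 1) zero_le_one
  rw [hausdorffMeasure_real, ENNReal.rpow_one, hinv.image_image] at this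
  have hK' : ENNReal.ofReal K * ((NNReal.mk K⁻¹ (inv_pos.2 hK).le : ℝ≥0) : ℝ≥0∞) = 1 := by
    have : ((NNReal.mk K⁻¹ (inv_pos.2 hK).le : ℝ≥0) : ℝ≥0∞) = ENNReal.ofReal K⁻¹ := by
      rw [ENNReal.ofReal, Real.toNNReal_of_nonneg (inv_pos.2 hK).le]
    rw [this, ← ENNReal.ofReal_mul hK.le, mul_inv_cancel₀ hK.ne', ENNReal.ofReal_one]
  calc ENNReal.ofReal K * volume I ≤ ENNReal.ofReal K * (_ * _) := mul_le_mul_right this _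
    _ = _ := by rw [← mul_assoc, hK', one_mul]

/-- The length of the arc `c((0, x])`. -/
noncomputable def arcLength (c : ℝ → Plane) (x : ℝ) : ℝ :=
  (Measure.hausdorffMeasure 1 : Measure Plane).real (c '' Ioc 0 x)

theorem exists_norm_sub_le_of_contDiff (hc : ContDiff ℝ 1 c) (ℓ : ℝ) :
    ∃ K ≥ 0, ∀ x ∈ Icc 0 ℓ, ∀ y ∈ Icc 0 ℓ, ‖c x - c y‖ ≤ K * |x - y| := by
  obtain ⟨K, hK⟩ := isCompact_Icc.exists_bound_of_continuousOn (s := Icc 0 ℓ)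
    (hc.continuous_deriv le_rfl).continuousOn
  refine ⟨|K|, abs_nonneg _, fun x hx y hy => ?_⟩
  have := (convex_Icc 0 ℓ).norm_image_sub_le_of_norm_deriv_le (𝕜 := ℝ)
    (fun z _ => hc.differentiable one_ne_zero z)
    (fun z hz => (hK z hz).trans (le_abs_self K)) hy hx
  simpa using this

theorem measurableSet_image_Ioc (hc : ContDiff ℝ 1 c) (a b : ℝ) :
    MeasurableSet (c '' Ioc a b) := by
  rcases le_or_gt b a with h | h
  · simp [Ioc_eq_empty (not_lt.2 h)]
  · have : Ioc a b = ⋃ n : ℕ, Icc (a + (b - a) / (n + 1)) b := by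
      ext x
      simp only [mem_Ioc, mem_iUnion, mem_Icc]
      constructor
      · rintro ⟨h1, h2⟩
        obtain ⟨n, hn⟩ := exists_nat_gt ((b - a) / (x - a))
        refine ⟨n, ?_, h2⟩
        rw [div_lt_iff₀ (by linarith)] at hn
        have : (b - a) / (n + 1) ≤ x - a := by
          rw [div_le_iff₀ (by positivity)]
          nlinarith
        linarith
      · rintro ⟨n, h1, h2⟩
        have : 0 < (b - a) / ((n : ℝ) + 1) := div_pos (by linarith) (by positivity)
        exact ⟨by linarith, h2⟩
    rw [this, image_iUnion]
    exact MeasurableSet.iUnion fun n => (isCompact_Icc.image hc.continuous).measurableSet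

theorem arcLength_sub (hc : ContDiff ℝ 1 c) (hinj : InjOn c (Ioc 0 ℓ)) {x y : ℝ} (hx : 0 ≤ x)
    (hxy : x ≤ y) (hy : y ≤ ℓ) :
    arcLength c y - arcLength c x = (Measure.hausdorffMeasure 1 : Measure Plane).real (c '' Ioc x y) ∧
      (Measure.hausdorffMeasure 1 : Measure Plane) (c '' Ioc x y) ≠ ⊤ := by
  obtain ⟨K, hK, hlip⟩ := exists_norm_sub_le_of_contDiff hc ℓ
  have hfin : ∀ a b : ℝ, 0 ≤ a → b ≤ ℓ →
      (Measure.hausdorffMeasure 1 : Measure Plane) (c '' Ioc a b) ≠ ⊤ := by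
    intro a b ha hb
    have hsub : Ioc a b ⊆ Icc 0 ℓ := fun z hz => ⟨ha.trans hz.1.le, hz.2.trans hb⟩
    refine ((hausdorffMeasure_image_le_of_norm_sub_le hK
      fun u hu w hw => hlip u (hsub hu) w (hsub hw)).trans_lt ?_).ne
    rw [Real.volume_Ioc]
    exact ENNReal.mul_lt_top ENNReal.ofReal_lt_top ENNReal.ofReal_lt_top
  refine ⟨?_, hfin x y hx hy⟩
  have hu : Ioc 0 y = Ioc 0 x ∪ Ioc x y := (Ioc_union_Ioc_eq_Ioc hx hxy).symm
  have hd : Disjoint (c '' Ioc 0 x) (c '' Ioc x y) := by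
    refine (disjoint_image_image ?_)
    intro a ha b hb hab
    have := hinj ⟨ha.1, ha.2.trans (hxy.trans hy)⟩ ⟨hx.trans_lt hb.1, hb.2.trans hy⟩ hab
    linarith [ha.2, hb.1]
  rw [arcLength, hu, image_union, measureReal_union hd (measurableSet_image_Ioc hc x y)
    (hfin 0 x le_rfl (hxy.trans hy)) (hfin x y hx hy), arcLength]
  ring

/-- Strict differentiability makes `c` nearly affine on a short arc, so it stretches distances by
factors between `‖c'(x)‖ - η` and `‖c'(x)‖ + η`. The two Lipschitz estimates squeeze the Hausdorff
measure of the arc accordingly. -/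
theorem hasDerivWithinAt_arcLength (hc : ContDiff ℝ 1 c) (hinj : InjOn c (Ioc 0 ℓ)) {x : ℝ}
    (hx : x ∈ Ico 0 ℓ) (hreg : deriv c x ≠ 0) :
    HasDerivWithinAt (arcLength c) ‖deriv c x‖ (Ioi x) x := by
  rw [hasDerivWithinAt_iff_tendsto_slope' (by simp), Metric.tendsto_nhds]
  intro κ hκ
  have hn : 0 < ‖deriv c x‖ := norm_pos_iff.2 hreg
  -- The first term keeps the error below `κ`, the second keeps the lower stretching factor
  -- positive.
  set η := min (κ / 2) (‖deriv c x‖ / 2)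
  have hη : 0 < η := by positivity
  have hs : HasStrictDerivAt c (deriv c x) x := hc.contDiffAt.hasStrictDerivAt one_ne_zero
  obtain ⟨U, hU, happ⟩ := hs.hasStrictFDerivAt.approximates_deriv_on_nhds
    (c := NNReal.mk η hη.le) (Or.inr hη)
  obtain ⟨δ, hδ, hball⟩ := Metric.mem_nhds_iff.1 hU
  filter_upwards [Ioo_mem_nhdsGT (show x < x + δ by linarith), Ioo_mem_nhdsGT hx.2] with y hy1 hy2
  have hxy : 0 < y - x := by linarith [hy1.1]
  have hsub : Ioc x y ⊆ U := fun z hz => hball (by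
    rw [Metric.mem_ball, Real.dist_eq, abs_of_pos (by linarith [hz.1])]; linarith [hz.2, hy1.2])
  have hlin : ∀ a ∈ Ioc x y, ∀ b ∈ Ioc x y,
      ‖c a - c b - (a - b) • deriv c x‖ ≤ η * |a - b| := fun a ha b hb => by
    simpa using happ a (hsub ha) b (hsub hb)
  have hn' : ∀ a b : ℝ, ‖(a - b) • deriv c x‖ = ‖deriv c x‖ * |a - b| := fun a b => by
    rw [norm_smul, Real.norm_eq_abs, mul_comm]
  have hup := hausdorffMeasure_image_le_of_norm_sub_le (c := c) (I := Ioc x y)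
    (K := ‖deriv c x‖ + η) (by positivity) fun a ha b hb => by
      have h1 := hlin a ha b hb
      have h2 := norm_sub_norm_le (c a - c b) ((a - b) • deriv c x)
      rw [hn'] at h2; linarith
  have hηn : 0 < ‖deriv c x‖ - η := by
    have : η ≤ ‖deriv c x‖ / 2 := min_le_right _ _
    linarith
  have hlo := le_hausdorffMeasure_image_of_le_norm_sub (c := c) (I := Ioc x y) hηn
    fun a ha b hb => by
      have h1 := hlin a ha b hb
      have h2 := norm_sub_norm_le ((a - b) • deriv c x) (c a - c b)
      rw [hn', norm_sub_rev ((a - b) • deriv c x)] at h2; linarith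
  obtain ⟨hdiff, hfin⟩ := arcLength_sub hc hinj hx.1 hy1.1.le hy2.2.le
  rw [Real.volume_Ioc, ← ENNReal.ofReal_mul (by positivity)] at hup
  rw [Real.volume_Ioc, ← ENNReal.ofReal_mul hηn.le] at hlo
  have hup' := ENNReal.toReal_le_of_le_ofReal (by positivity) hup
  have hlo' := (ENNReal.ofReal_le_iff_le_toReal hfin).1 hlo
  rw [slope_def_field, hdiff, Real.dist_eq]
  have h3 : η < κ := (min_le_left _ _).trans_lt (by linarith)
  refine lt_of_le_of_lt (abs_le.2 ⟨?_, ?_⟩) h3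
  · rw [neg_le_sub_iff_le_add, ← sub_le_iff_le_add, le_div_iff₀ hxy]; exact hlo'
  · rw [sub_le_iff_le_add, div_le_iff₀ hxy, add_comm]; exact hup'

theorem continuousOn_arcLength (hc : ContDiff ℝ 1 c) (hinj : InjOn c (Ioc 0 ℓ)) :
    ContinuousOn (arcLength c) (Icc 0 ℓ) := by
  obtain ⟨K, hK, hlip⟩ := exists_norm_sub_le_of_contDiff hc ℓ
  have key : ∀ x y : ℝ, 0 ≤ x → x ≤ y → y ≤ ℓ →
      dist (arcLength c y) (arcLength c x) ≤ K * dist y x := by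
    intro x y hx hxy hy
    obtain ⟨hdiff, hfin⟩ := arcLength_sub hc hinj hx hxy hy
    have hsub : Ioc x y ⊆ Icc 0 ℓ := fun z hz => ⟨hx.trans hz.1.le, hz.2.trans hy⟩
    have hup := hausdorffMeasure_image_le_of_norm_sub_le hK
      fun u hu w hw => hlip u (hsub hu) w (hsub hw)
    rw [Real.volume_Ioc, ← ENNReal.ofReal_mul hK] at hup
    rw [Real.dist_eq, hdiff, abs_of_nonneg measureReal_nonneg, Real.dist_eq,
      abs_of_nonneg (sub_nonneg.2 hxy)]
    exact ENNReal.toReal_le_of_le_ofReal (mul_nonneg hK (sub_nonneg.2 hxy)) hup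
  refine (LipschitzOnWith.of_dist_le_mul (K := NNReal.mk K hK) fun x hx y hy => ?_).continuousOn
  rcases le_total x y with h | h
  · rw [dist_comm, dist_comm x y]; exact key x y hx.1 h hy.2
  · exact key y x hy.1 h hx.2

/-- The length of a simple closed regular `C¹` curve is the integral of its speed. -/
theorem hausdorffMeasure_range_eq_integral (hℓ : 0 < ℓ) (hc : ContDiff ℝ 1 c)
    (hper : Function.Periodic c ℓ) (hinj : InjOn c (Ioc 0 ℓ)) (hreg : ∀ s, deriv c s ≠ 0) :
    (Measure.hausdorffMeasure 1 : Measure Plane).real (range c) =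
      ∫ s in (0 : ℝ)..ℓ, ‖deriv c s‖ := by
  have h := intervalIntegral.integral_eq_sub_of_hasDeriv_right_of_le hℓ.le
    (continuousOn_arcLength hc hinj)
    (fun x hx => hasDerivWithinAt_arcLength hc hinj (Ioo_subset_Ico_self hx) (hreg x))
    ((hc.continuous_deriv le_rfl).norm.intervalIntegrable 0 ℓ)
  have h0 : arcLength c 0 = 0 := by simp [arcLength]
  have hr := hper.image_Ioc hℓ 0
  rw [zero_add] at hr
  rw [h, h0, sub_zero, arcLength, hr]

end Length

/-! ### Differentiation of the length -/

section LengthDerivative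

variable {Ω : Set Plane} {γ : ℝ → Plane} {ℓ : ℝ} {T : ℝ → Plane ≃ Plane} {ε : ℝ}

/-- Arcs `c '' Ioc 0 x` are open at their start, so injectivity is needed on the other half-open
period. -/
theorem IsJordanRegion.injOn_Ioc (hΩ : IsJordanRegion Ω γ ℓ) : InjOn γ (Ioc 0 ℓ) := by
  obtain ⟨δ, hδ, hinj, -⟩ := hΩ.exists_tube
  intro x hx y hy hxy
  have h := hinj (x₁ := (x, 0)) (x₂ := (y, 0)) ⟨hx, by simpa using hδ⟩ ⟨hy, by simpa using hδ⟩
    (by simpa using hxy)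
  exact (Prod.mk.inj h).1

theorem IsDeformation.hasDerivAt_comp (hT : IsDeformation T ε) (hΩ : IsJordanRegion Ω γ ℓ) {t : ℝ}
    (ht : t ∈ Ico 0 ε) (s : ℝ) :
    HasDerivAt (fun u => T t (γ u)) (fderiv ℝ (T t) (γ s) (deriv γ s)) s :=
  HasFDerivAt.comp_hasDerivAt s
    ((hT.contDiff t ht).differentiable one_ne_zero (γ s)).hasFDerivAt (hΩ.hasDerivAt s)

theorem IsDeformation.fderiv_injective (hT : IsDeformation T ε) {t : ℝ} (ht : t ∈ Ico 0 ε)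
    (x : Plane) : Function.Injective (fderiv ℝ (T t) x) := by
  have h1 := ((hT.contDiff_symm t ht).differentiable one_ne_zero (T t x)).hasFDerivAt.comp x
    ((hT.contDiff t ht).differentiable one_ne_zero x).hasFDerivAt
  have h2 : ((T t).symm ∘ T t : Plane → Plane) = id := by ext y; simp
  rw [h2] at h1
  have h3 := h1.unique (hasFDerivAt_id x)
  intro v w hvw
  have h4 : ∀ u, fderiv ℝ (T t).symm (T t x) (fderiv ℝ (T t) x u) = u := fun u =>
    congrArg (fun L : Plane →L[ℝ] Plane => L u) h3
  rw [← h4 v, ← h4 w, hvw]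

/-- A homeomorphism carries frontier to frontier, and `T_t ∘ γ` is again a simple closed regular
`C¹` curve, regular because `DT_t` is injective. -/
theorem E₃_image (hT : IsDeformation T ε) (hΩ : IsJordanRegion Ω γ ℓ) {t : ℝ} (ht : t ∈ Ico 0 ε) :
    E₃ (T t '' Ω) = ∫ s in (0 : ℝ)..ℓ, ‖fderiv ℝ (T t) (γ s) (deriv γ s)‖ := by
  let e : Plane ≃ₜ Plane :=
    { T t with
      continuous_toFun := (hT.contDiff t ht).continuous
      continuous_invFun := (hT.contDiff_symm t ht).continuous }
  have hfr : frontier (T t '' Ω) = range fun s => T t (γ s) := by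
    have : frontier (e '' Ω) = e '' frontier Ω := (e.image_frontier Ω).symm
    rw [hΩ.frontier_eq, ← range_comp] at this
    exact this
  have hd := hT.hasDerivAt_comp hΩ ht
  have hder : deriv (fun s => T t (γ s)) = fun s => fderiv ℝ (T t) (γ s) (deriv γ s) :=
    funext fun s => (hd s).deriv
  rw [E₃, hfr, hausdorffMeasure_range_eq_integral (c := fun s => T t (γ s)) hΩ.period_pos
    ((hT.contDiff t ht).comp (hΩ.contDiff.of_le one_le_two))
    (fun s => congrArg (T t) (hΩ.periodic s)) ((T t).injective.comp_injOn hΩ.injOn_Ioc), hder]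
  intro s hs
  rw [hder] at hs
  refine hΩ.regular s (hT.fderiv_injective ht (γ s) ?_)
  rw [map_zero]; exact hs

theorem hasDerivWithinAt_norm {f : ℝ → Plane} {f' : Plane} {S : Set ℝ} {x : ℝ}
    (hf : HasDerivWithinAt f f' S x) (h0 : f x ≠ 0) :
    HasDerivWithinAt (fun t => ‖f t‖) (inner ℝ f' (f x) / ‖f x‖) S x := by
  have h := hf.norm_sq.sqrt (by simpa using h0)
  simp only [Real.sqrt_sq (norm_nonneg _)] at h
  rw [real_inner_comm, mul_div_mul_left _ _ two_ne_zero] at h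
  exact h

theorem IsDeformation.fderiv_zero (hT : IsDeformation T ε) (x : Plane) :
    fderiv ℝ (T 0) x = ContinuousLinearMap.id ℝ Plane := by
  have : (T 0 : Plane → Plane) = id := funext hT.zero
  rw [this, fderiv_id]

theorem IsDeformation.hasDerivWithinAt_fderiv_apply (hT : IsDeformation T ε) (x v : Plane) :
    HasDerivWithinAt (fun t => fderiv ℝ (T t) x v) (fderiv ℝ (lagrangianVelocity T ε 0) x v)
      (Ioi 0) 0 := by
  rw [hasDerivWithinAt_iff_tendsto_slope' (by simp), Metric.tendsto_nhds]
  intro κ hκ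
  set κ' := κ / (2 * (‖v‖ + 1))
  have hκ' : 0 < κ' := by positivity
  obtain ⟨t₀, ht₀, H⟩ := hT.exists_norm_fderiv_sub_le (‖x‖ + 1) hκ'
  filter_upwards [Ioc_mem_nhdsGT ht₀.1] with t ht
  have h1 := H t ⟨ht.1.le, ht.2⟩ x (by simp)
  have h2 := ContinuousLinearMap.le_of_opNorm_le _ h1 v
  have h3 : slope (fun t => fderiv ℝ (T t) x v) 0 t - fderiv ℝ (lagrangianVelocity T ε 0) x v =
      t⁻¹ • ((fderiv ℝ (T t) x - ContinuousLinearMap.id ℝ Plane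
        - t • fderiv ℝ (lagrangianVelocity T ε 0) x) v) := by
    simp [slope_def_module, hT.fderiv_zero, smul_sub, smul_smul, inv_mul_cancel₀ ht.1.ne']
  rw [dist_eq_norm, h3, norm_smul, norm_inv, Real.norm_eq_abs, abs_of_pos ht.1,
    inv_mul_lt_iff₀ ht.1]
  have h4 : κ' * (2 * (‖v‖ + 1)) = κ := div_mul_cancel₀ _ (by positivity)
  refine h2.trans_lt ?_
  rw [← h4]
  have := mul_pos hκ' ht.1
  nlinarith [norm_nonneg v]

theorem hasDerivWithinAt_norm_fderiv (hT : IsDeformation T ε) (hΩ : IsJordanRegion Ω γ ℓ) (s : ℝ) :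
    HasDerivWithinAt (fun t => ‖fderiv ℝ (T t) (γ s) (deriv γ s)‖)
      (inner ℝ (fderiv ℝ (lagrangianVelocity T ε 0) (γ s) (deriv γ s)) (deriv γ s)
        / ‖deriv γ s‖) (Ioi 0) 0 := by
  have h := hasDerivWithinAt_norm (hT.hasDerivWithinAt_fderiv_apply (γ s) (deriv γ s))
    (by simpa [hT.fderiv_zero] using hΩ.regular s)
  simpa [hT.fderiv_zero] using h

/-- The first variation of the length in terms of the velocity along the curve. -/
theorem hasDerivWithinAt_E₃ (hT : IsDeformation T ε) (hΩ : IsJordanRegion Ω γ ℓ) :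
    HasDerivWithinAt (fun t => E₃ (T t '' Ω))
      (∫ s in (0 : ℝ)..ℓ,
        inner ℝ (fderiv ℝ (lagrangianVelocity T ε 0) (γ s) (deriv γ s)) (deriv γ s)
          / ‖deriv γ s‖) (Ioi 0) 0 := by
  have hcont : ∀ t ∈ Ico 0 ε, Continuous fun s => ‖fderiv ℝ (T t) (γ s) (deriv γ s)‖ := fun t ht =>
    ((((hT.contDiff t ht).continuous_fderiv one_ne_zero).comp hΩ.continuous_curve).clm_apply
      hΩ.contDiff_deriv.continuous).norm
  have hIco : ∀ᶠ t in 𝓝[>] (0 : ℝ), t ∈ Ico 0 ε :=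
    mem_of_superset (Ioo_mem_nhdsGT hT.pos) Ioo_subset_Ico_self
  obtain ⟨R, hR⟩ := hΩ.isCompact_range.isBounded.subset_ball (0 : Plane)
  obtain ⟨t₀, ht₀, H⟩ := hT.exists_norm_fderiv_sub_le R one_pos
  rw [hasDerivWithinAt_iff_tendsto_slope' (by simp)]
  have hlim : Tendsto (fun t => ∫ s in (0 : ℝ)..ℓ,
      slope (fun t => ‖fderiv ℝ (T t) (γ s) (deriv γ s)‖) 0 t) (𝓝[>] 0)
      (𝓝 (∫ s in (0 : ℝ)..ℓ,
        inner ℝ (fderiv ℝ (lagrangianVelocity T ε 0) (γ s) (deriv γ s)) (deriv γ s)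
          / ‖deriv γ s‖)) := by
    -- The expansion of `DT_t` with error constant `1` gives `‖DT_t - id‖ ≤ (1 + ‖DV(0)‖) t` on the
    -- curve; the reverse triangle inequality passes this to the difference quotients of the speed.
    refine intervalIntegral.tendsto_integral_filter_of_dominated_convergence
      (fun s => (1 + ‖fderiv ℝ (lagrangianVelocity T ε 0) (γ s)‖) * ‖deriv γ s‖) ?_ ?_ ?_ ?_
    · filter_upwards [hIco] with t ht
      simp only [slope_def_field]
      exact (((hcont t ht).sub (hcont 0 hT.zero_mem)).div_const _).aestronglyMeasurable
    · filter_upwards [Ioc_mem_nhdsGT ht₀.1] with t ht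
      refine Eventually.of_forall fun s _ => ?_
      have h1 := H t ⟨ht.1.le, ht.2⟩ (γ s) (hR (mem_range_self s))
      set L := fderiv ℝ (lagrangianVelocity T ε 0) (γ s)
      have h2 : ‖fderiv ℝ (T t) (γ s) - ContinuousLinearMap.id ℝ Plane‖ ≤ (1 + ‖L‖) * t := by
        have h3 : ‖t • L‖ = t * ‖L‖ := by rw [norm_smul, Real.norm_eq_abs, abs_of_pos ht.1]
        have h4 := norm_sub_norm_le (fderiv ℝ (T t) (γ s) - ContinuousLinearMap.id ℝ Plane) (t • L)
        linarith
      have h5 := ContinuousLinearMap.le_of_opNorm_le _ h2 (deriv γ s)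
      have h6 := abs_norm_sub_norm_le (fderiv ℝ (T t) (γ s) (deriv γ s)) (deriv γ s)
      rw [slope_def_field, sub_zero, hT.fderiv_zero, Real.norm_eq_abs, abs_div, abs_of_pos ht.1,
        div_le_iff₀ ht.1]
      refine h6.trans (h5.trans (le_of_eq ?_))
      ring
    · refine Continuous.intervalIntegrable ?_ _ _
      exact (continuous_const.add ((hT.contDiff_velocity_zero.continuous_fderiv one_ne_zero).comp
        hΩ.continuous_curve).norm).mul hΩ.contDiff_deriv.continuous.norm
    · refine Eventually.of_forall fun s _ => ?_
      exact (hasDerivWithinAt_iff_tendsto_slope' (by simp)).1 (hasDerivWithinAt_norm_fderiv hT hΩ s)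
  refine hlim.congr' ?_
  filter_upwards [hIco] with t ht
  simp only [slope_def_field]
  rw [E₃_image hT hΩ ht, E₃_image hT hΩ hT.zero_mem, intervalIntegral.integral_div,
    intervalIntegral.integral_sub ((hcont t ht).intervalIntegrable _ _)
      ((hcont 0 hT.zero_mem).intervalIntegrable _ _)]

/-- The Frenet equation for the unit tangent. -/
theorem IsJordanRegion.hasDerivAt_unitTangent (hΩ : IsJordanRegion Ω γ ℓ) (s : ℝ) :
    HasDerivAt (fun u => ‖deriv γ u‖⁻¹ • deriv γ u)
      (-(curvature γ s * ‖deriv γ s‖) • rightNormal γ s) s := by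
  have h0 := hΩ.norm_deriv_pos s
  have h2 : HasDerivAt (deriv γ) (deriv (deriv γ) s) s :=
    (hΩ.contDiff_deriv.differentiable one_ne_zero s).hasDerivAt
  have hn : HasDerivAt (fun u => ‖deriv γ u‖)
      (inner ℝ (deriv (deriv γ) s) (deriv γ s) / ‖deriv γ s‖) s := by
    rw [← hasDerivWithinAt_univ] at h2 ⊢
    exact hasDerivWithinAt_norm h2 (hΩ.regular s)
  refine ((hn.inv h0.ne').smul h2).congr_deriv ?_
  have hq := norm_sq_plane (deriv γ s)
  ext i
  fin_cases i
  · simp [curvature, inner_plane]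
    field_simp
    rw [hq]; ring
  · simp [curvature, inner_plane]
    field_simp
    rw [hq]; ring

theorem IsJordanRegion.continuous_curvature (hΩ : IsJordanRegion Ω γ ℓ) :
    Continuous (curvature γ) := by
  have h2 : Continuous (deriv (deriv γ)) := hΩ.contDiff_deriv.continuous_deriv le_rfl
  have h1 := fun i => (hΩ.contDiff_deriv_apply i).continuous
  have h2' : ∀ i, Continuous fun s => deriv (deriv γ) s i := fun i =>
    (EuclideanSpace.proj (𝕜 := ℝ) i).continuous.comp h2
  exact (((h1 0).mul (h2' 1)).sub ((h1 1).mul (h2' 0))).div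
    (hΩ.contDiff_deriv.continuous.norm.pow 3) fun s => (pow_pos (hΩ.norm_deriv_pos s) 3).ne'

/-- The tangential component of the velocity is periodic along the curve, so its derivative
integrates to zero over a period. By the Frenet equation that derivative is the difference of the
two integrands. -/
theorem integral_tangential_eq_arcIntegral (hT : IsDeformation T ε) (hΩ : IsJordanRegion Ω γ ℓ) :
    (∫ s in (0 : ℝ)..ℓ,
        inner ℝ (fderiv ℝ (lagrangianVelocity T ε 0) (γ s) (deriv γ s)) (deriv γ s)
          / ‖deriv γ s‖) =
      arcIntegral γ ℓ fun s => curvature γ s * normalVelocity T ε γ s := by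
  set W := lagrangianVelocity T ε 0
  have hW := hT.contDiff_velocity_zero
  have ha : Continuous fun s => inner ℝ (fderiv ℝ W (γ s) (deriv γ s)) (deriv γ s)
      / ‖deriv γ s‖ :=
    ((((hW.continuous_fderiv one_ne_zero).comp hΩ.continuous_curve).clm_apply
      hΩ.contDiff_deriv.continuous).inner hΩ.contDiff_deriv.continuous).div
      hΩ.contDiff_deriv.continuous.norm fun s => (hΩ.norm_deriv_pos s).ne'
  have hb : Continuous fun s => curvature γ s * normalVelocity T ε γ s * ‖deriv γ s‖ :=
    (hΩ.continuous_curvature.mul (continuous_normalVelocity hΩ hT)).mul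
      hΩ.contDiff_deriv.continuous.norm
  have hd : ∀ s, HasDerivAt (fun u => inner ℝ (W (γ u)) (‖deriv γ u‖⁻¹ • deriv γ u))
      (inner ℝ (fderiv ℝ W (γ s) (deriv γ s)) (deriv γ s) / ‖deriv γ s‖
        - curvature γ s * normalVelocity T ε γ s * ‖deriv γ s‖) s := by
    intro s
    have h1 : HasDerivAt (fun u => W (γ u)) (fderiv ℝ W (γ s) (deriv γ s)) s :=
      HasFDerivAt.comp_hasDerivAt s (hW.differentiable one_ne_zero (γ s)).hasFDerivAt
        (hΩ.hasDerivAt s)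
    refine (h1.inner ℝ (hΩ.hasDerivAt_unitTangent s)).congr_deriv ?_
    rw [inner_smul_right, inner_smul_right, normalVelocity_eq hT]
    ring
  have hint := intervalIntegral.integral_eq_sub_of_hasDerivAt (a := 0) (b := ℓ)
    (fun s _ => hd s) ((ha.sub hb).intervalIntegrable _ _)
  have h0 : γ ℓ = γ 0 := by simpa using hΩ.periodic 0
  have h1 : deriv γ ℓ = deriv γ 0 := by simpa using hΩ.periodic_deriv 0
  rw [h0, h1, sub_self, intervalIntegral.integral_sub (ha.intervalIntegrable _ _)
    (hb.intervalIntegrable _ _)] at hint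
  exact sub_eq_zero.1 hint

end LengthDerivative
/-! ### Differentiation of the energy -/

section Energy

variable {D Ω : Set Plane} {γ : ℝ → Plane} {ℓ : ℝ} {T : ℝ → Plane ≃ Plane} {ε : ℝ} {f : Plane → ℝ}

theorem IsDeformation.hasEulerianDerivative_iff (hT : IsDeformation T ε) {J : Set Plane → ℝ}
    {d : ℝ} :
    HasEulerianDerivative J T Ω d ↔ HasDerivWithinAt (fun t => J (T t '' Ω)) d (Ioi 0) 0 := by
  rw [hasDerivWithinAt_iff_tendsto_slope' (by simp), HasEulerianDerivative]
  refine tendsto_congr fun t => ?_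
  rw [slope_def_field, hT.image_zero, sub_zero]

theorem arcIntegral_add {a b : ℝ → ℝ} (hΩ : IsJordanRegion Ω γ ℓ) (ha : Continuous a)
    (hb : Continuous b) :
    arcIntegral γ ℓ (fun s => a s + b s) = arcIntegral γ ℓ a + arcIntegral γ ℓ b := by
  have hn := hΩ.contDiff_norm_deriv.continuous
  simp only [arcIntegral, add_mul]
  exact intervalIntegral.integral_add ((ha.mul hn).intervalIntegrable _ _)
    ((hb.mul hn).intervalIntegrable _ _)

theorem arcIntegral_const_mul (c : ℝ) (a : ℝ → ℝ) :
    arcIntegral γ ℓ (fun s => c * a s) = c * arcIntegral γ ℓ a := by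
  simp only [arcIntegral, mul_assoc, intervalIntegral.integral_const_mul]

theorem regionVariance_eq {S : Set Plane} (hS : volume S ≠ ⊤) (hf : MemLp f 2 (volume.restrict S)) :
    regionVariance f S = (∫ x in S, f x ^ 2) / volume.real S
      - ((∫ x in S, f x) / volume.real S) ^ 2 := by
  have : IsFiniteMeasure (volume.restrict S) := ⟨by simpa using hS.lt_top⟩
  -- For zero area both sides vanish because division by zero gives zero.
  rcases eq_or_ne (volume.real S) 0 with h0 | h0
  · simp [regionVariance, h0]
  have i1 : Integrable f (volume.restrict S) := hf.integrable one_le_two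
  have i2 : Integrable (fun x => f x ^ 2) (volume.restrict S) := hf.integrable_sq
  set m := mean f S
  have hm : m = (∫ x in S, f x) / volume.real S := by simp [m, mean, div_eq_inv_mul]
  have he : ∫ x in S, (f x - m) ^ 2 =
      (∫ x in S, f x ^ 2) - 2 * m * (∫ x in S, f x) + m ^ 2 * volume.real S := by
    have h1 : ∀ x, (f x - m) ^ 2 = f x ^ 2 - 2 * m * f x + m ^ 2 := fun x => by ring
    simp only [h1]
    rw [integral_add (f := fun x => f x ^ 2 - 2 * m * f x) (i2.sub (i1.const_mul _))
      (integrable_const _),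
      integral_sub i2 (i1.const_mul _), integral_const_mul, setIntegral_const]
    simp [mul_comm]
  rw [regionVariance, he, hm]
  field_simp
  ring

/-- The derivative of the variance, from those of the area and of the first two moments. -/
theorem hasDerivWithinAt_variance {A I Q : ℝ → ℝ} {A' I' Q' : ℝ} {S : Set ℝ} {x : ℝ}
    (hA : HasDerivWithinAt A A' S x) (hI : HasDerivWithinAt I I' S x)
    (hQ : HasDerivWithinAt Q Q' S x) (h0 : A x ≠ 0) :
    HasDerivWithinAt (fun t => Q t / A t - (I t / A t) ^ 2)
      (1 / A x * Q' - 1 / A x ^ 2 * (Q x * A' + 2 * I x * I' - 2 / A x * I x ^ 2 * A')) S x := by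
  refine ((hQ.div hA h0).sub ((hI.div hA h0).pow 2)).congr_deriv ?_
  simp only [Pi.div_apply, Nat.cast_ofNat, Nat.add_one_sub_one, pow_one]
  field_simp
  ring

/-- `δE₁` is a quadratic polynomial in the boundary value of `f`, so its boundary integral is a
combination of the derivatives of area and moments. -/
theorem arcIntegral_quadratic {h v : ℝ → ℝ} (hΩ : IsJordanRegion Ω γ ℓ) (hh : Continuous h)
    (hv : Continuous v) (a b c : ℝ) :
    arcIntegral γ ℓ (fun s => (a * h s ^ 2 + b * h s + c) * v s) =
      a * arcIntegral γ ℓ (fun s => h s ^ 2 * v s) + b * arcIntegral γ ℓ (fun s => h s * v s)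
        + c * arcIntegral γ ℓ v := by
  simp only [← arcIntegral_const_mul]
  have h2 : Continuous fun s => a * (h s ^ 2 * v s) := continuous_const.mul ((hh.pow 2).mul hv)
  have h1 : Continuous fun s => b * (h s * v s) := continuous_const.mul (hh.mul hv)
  have h0 : Continuous fun s => c * v s := continuous_const.mul hv
  rw [← arcIntegral_add hΩ h2 h1, 
    ← arcIntegral_add (a := fun s => a * (h s ^ 2 * v s) + b * (h s * v s)) hΩ (h2.add h1) h0]
  congr 1
  ext s
  ring

theorem δE₁_eq (f : Plane → ℝ) (Ω : Set Plane) (x : Plane) :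
    δE₁ f Ω x = 1 / volume.real Ω * f x ^ 2
      + -(2 / volume.real Ω ^ 2 * ∫ y in Ω, f y) * f x
      + -(1 / volume.real Ω ^ 2 * ((∫ y in Ω, f y ^ 2)
        - 2 / volume.real Ω * (∫ y in Ω, f y) ^ 2)) := by
  rw [δE₁]; ring

/-- The background is treated as a region whose outward normal is reversed along `Γ`. -/
theorem δE₂_eq (f : Plane → ℝ) (D Ω : Set Plane) (x : Plane) : δE₂ f D Ω x = -δE₁ f (D \ Ω) x := by
  rw [δE₂, δE₁]; ring

/-- The derivative of the variance of `f` along a family of sets with differentiable area and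
moments is the boundary integral of `δE₁`, up to the sign `σ` of the normal. -/
theorem hasDerivWithinAt_regionVariance (hΩ : IsJordanRegion Ω γ ℓ) {v : ℝ → ℝ}
    (hfγ : Continuous fun s => f (γ s)) (hv : Continuous v) (σ : ℝ) {S : ℝ → Set Plane}
    (hfin : ∀ᶠ t in 𝓝[≥] (0 : ℝ), volume (S t) ≠ ⊤ ∧ MemLp f 2 (volume.restrict (S t)))
    (hS : volume.real (S 0) ≠ 0)
    (dA : HasDerivWithinAt (fun t => volume.real (S t)) (σ * arcIntegral γ ℓ v) (Ioi 0) 0)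
    (dI : HasDerivWithinAt (fun t => ∫ x in S t, f x)
      (σ * arcIntegral γ ℓ fun s => f (γ s) * v s) (Ioi 0) 0)
    (dQ : HasDerivWithinAt (fun t => ∫ x in S t, f x ^ 2)
      (σ * arcIntegral γ ℓ fun s => f (γ s) ^ 2 * v s) (Ioi 0) 0) :
    HasDerivWithinAt (fun t => regionVariance f (S t))
      (σ * arcIntegral γ ℓ fun s => δE₁ f (S 0) (γ s) * v s) (Ioi 0) 0 := by
  have h := hasDerivWithinAt_variance dA dI dQ hS
  -- The filter includes `t = 0`, since replacing the function also requires agreement at the base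
  -- point.
  have he : ∀ᶠ t in 𝓝[≥] (0 : ℝ), regionVariance f (S t) =
      (∫ x in S t, f x ^ 2) / volume.real (S t) - ((∫ x in S t, f x) / volume.real (S t)) ^ 2 :=
    hfin.mono fun t ht => regionVariance_eq ht.1 ht.2
  refine (h.congr_of_eventuallyEq (he.filter_mono (nhdsWithin_mono _ Ioi_subset_Ici_self))
    (he.self_of_nhdsWithin (mem_Ici.2 le_rfl))).congr_deriv ?_
  simp only [δE₁_eq]
  rw [arcIntegral_quadratic hΩ hfγ hv]
  ring

theorem hasEulerianDerivative_E₁ (hD : IsClosed D) (hDfin : volume D ≠ ⊤)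
    (hΩ : IsJordanRegion Ω γ ℓ) (hf : MemLp f 2 (volume.restrict D))
    (hfΓ : ∀ x ∈ frontier Ω, ContinuousWithinAt f D x)
    (hT : IsDeformation T ε) (hTD : ∀ t ∈ Ico 0 ε, T t '' Ω ⊆ D) :
    HasEulerianDerivative (E₁ f) T Ω
      (arcIntegral γ ℓ fun s => δE₁ f Ω (γ s) * normalVelocity T ε γ s) := by
  have hΩD := hT.subset hTD
  have : IsFiniteMeasure (volume.restrict D) := ⟨by simpa using hDfin.lt_top⟩
  have hne : Ω.Nonempty := by
    obtain ⟨r, hr⟩ := (hΩ.outward 0).exists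
    exact ⟨_, hr.1⟩
  have hIco : ∀ᶠ t in 𝓝[≥] (0 : ℝ), t ∈ Ico 0 ε := Ico_mem_nhdsGE hT.pos
  -- The area is the case `g = 1` of the transport theorem. The moments below use `f`, integrable
  -- because `D` has finite area, and `f ^ 2`.
  have dA := hasDerivWithinAt_setIntegral hD hΩ hT hTD
    (g := fun _ => 1) (integrable_const (1 : ℝ))
    fun x hx => continuousWithinAt_const
  rw [hT.hasEulerianDerivative_iff]
  have h := hasDerivWithinAt_regionVariance hΩ (hΩ.continuous_comp hD hΩD hfΓ)
    (continuous_normalVelocity hΩ hT) 1 (S := fun t => T t '' Ω)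
    (hIco.mono fun t ht => ⟨measure_ne_top_of_subset (hTD t ht) hDfin,
      hf.mono_measure (Measure.restrict_mono (hTD t ht) le_rfl)⟩)
    (by
      rw [hT.image_zero]
      exact (measureReal_ne_zero_iff (measure_ne_top_of_subset hΩD hDfin)).2
        (hΩ.isOpen.measure_pos volume hne).ne')
    (by simpa using dA)
    (by
      rw [one_mul]
      exact hasDerivWithinAt_setIntegral hD hΩ hT hTD (hf.integrable one_le_two) hfΓ)
    (by
      rw [one_mul]
      exact hasDerivWithinAt_setIntegral hD hΩ hT hTD hf.integrable_sq
        fun x hx => (hfΓ x hx).pow 2)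
  rw [one_mul] at h
  simpa only [E₁, hT.image_zero] using h

theorem hasDerivWithinAt_setIntegral_sdiff {g : Plane → ℝ} (hD : IsClosed D)
    (hΩ : IsJordanRegion Ω γ ℓ) (hT : IsDeformation T ε) (hTD : ∀ t ∈ Ico 0 ε, T t '' Ω ⊆ D)
    (hgD : IntegrableOn g D) (hg : ∀ x ∈ frontier Ω, ContinuousWithinAt g D x) :
    HasDerivWithinAt (fun t => ∫ x in D \ T t '' Ω, g x)
      (-1 * arcIntegral γ ℓ fun s => g (γ s) * normalVelocity T ε γ s) (Ioi 0) 0 := by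
  have h := (hasDerivWithinAt_setIntegral hD hΩ hT hTD hgD hg).const_sub (∫ x in D, g x)
  have he : ∀ᶠ t in 𝓝[≥] (0 : ℝ), ∫ x in D \ T t '' Ω, g x =
      (∫ x in D, g x) - ∫ x in T t '' Ω, g x := by
    filter_upwards [Ico_mem_nhdsGE hT.pos] with t ht
    rw [setIntegral_sdiff (hT.isOpen_image hΩ.isOpen ht).measurableSet hgD (hTD t ht)]
  rw [neg_one_mul]
  exact h.congr_of_eventuallyEq (he.filter_mono (nhdsWithin_mono _ Ioi_subset_Ici_self))
    (he.self_of_nhdsWithin (mem_Ici.2 le_rfl))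

theorem hasEulerianDerivative_E₂ (hD : IsClosed D) (hDfin : volume D ≠ ⊤)
    (hΩ : IsJordanRegion Ω γ ℓ) (hΩc : volume (D \ Ω) ≠ 0) (hf : MemLp f 2 (volume.restrict D))
    (hfΓ : ∀ x ∈ frontier Ω, ContinuousWithinAt f D x)
    (hT : IsDeformation T ε) (hTD : ∀ t ∈ Ico 0 ε, T t '' Ω ⊆ D) :
    HasEulerianDerivative (E₂ f D) T Ω
      (arcIntegral γ ℓ fun s => δE₂ f D Ω (γ s) * normalVelocity T ε γ s) := by
  have : IsFiniteMeasure (volume.restrict D) := ⟨by simpa using hDfin.lt_top⟩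
  have dA := hasDerivWithinAt_setIntegral_sdiff hD hΩ hT hTD
    (g := fun _ => 1) (integrable_const (1 : ℝ))
    fun x hx => continuousWithinAt_const
  rw [hT.hasEulerianDerivative_iff]
  have h := hasDerivWithinAt_regionVariance hΩ (hΩ.continuous_comp hD (hT.subset hTD) hfΓ)
    (continuous_normalVelocity hΩ hT) (-1) (S := fun t => D \ T t '' Ω)
    (Eventually.of_forall fun t => ⟨measure_ne_top_of_subset sdiff_subset hDfin,
      hf.mono_measure (Measure.restrict_mono sdiff_subset le_rfl)⟩)
    (by
      rw [hT.image_zero]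
      exact (measureReal_ne_zero_iff (measure_ne_top_of_subset sdiff_subset hDfin)).2 hΩc)
    (by simpa using dA)
    (hasDerivWithinAt_setIntegral_sdiff hD hΩ hT hTD (hf.integrable one_le_two) hfΓ)
    (hasDerivWithinAt_setIntegral_sdiff hD hΩ hT hTD hf.integrable_sq
        fun x hx => (hfΓ x hx).pow 2)
  rw [← arcIntegral_const_mul] at h
  simpa only [E₂, hT.image_zero, δE₂_eq, neg_mul, one_mul] using h

theorem hasEulerianDerivative_E₃ (hΩ : IsJordanRegion Ω γ ℓ) (hT : IsDeformation T ε) :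
    HasEulerianDerivative E₃ T Ω
      (arcIntegral γ ℓ fun s => curvature γ s * normalVelocity T ε γ s) := by
  rw [hT.hasEulerianDerivative_iff, ← integral_tangential_eq_arcIntegral hT hΩ]
  exact hasDerivWithinAt_E₃ hT hΩ

theorem continuous_δE₁ {h : ℝ → Plane} (hfh : Continuous fun s => f (h s)) (S : Set Plane) :
    Continuous fun s => δE₁ f S (h s) := by
  simp only [δE₁_eq]
  exact ((continuous_const.mul (hfh.pow 2)).add (continuous_const.mul hfh)).add continuous_const

end Energy
end MumfordShah

/-! ### The shape gradient of the full energy. -/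

theorem mainTheorem1
    (D Ω : Set MumfordShah.Plane) (f : MumfordShah.Plane → ℝ) (η : ℝ)
    (γ : ℝ → MumfordShah.Plane) (ℓ : ℝ)
    (T : ℝ → MumfordShah.Plane ≃ MumfordShah.Plane) (ε : ℝ)
    (hD : IsClosed D) (hDfin : volume D ≠ ⊤)
    (hΩ : MumfordShah.IsJordanRegion Ω γ ℓ)
    (hΩc : volume (D \ Ω) ≠ 0)
    (hf : MemLp f 2 (volume.restrict D))
    (hfΓ : ∀ x ∈ frontier Ω, ContinuousWithinAt f D x)
    (hT : MumfordShah.IsDeformation T ε)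
    (hTD : ∀ t ∈ Ico 0 ε, T t '' Ω ⊆ D) :
    MumfordShah.HasEulerianDerivative (MumfordShah.E₁ f) T Ω
        (MumfordShah.arcIntegral γ ℓ fun s =>
          MumfordShah.δE₁ f Ω (γ s) * MumfordShah.normalVelocity T ε γ s) ∧
      MumfordShah.HasEulerianDerivative (MumfordShah.E₂ f D) T Ω
        (MumfordShah.arcIntegral γ ℓ fun s =>
          MumfordShah.δE₂ f D Ω (γ s) * MumfordShah.normalVelocity T ε γ s) ∧
      MumfordShah.HasEulerianDerivative MumfordShah.E₃ T Ω
        (MumfordShah.arcIntegral γ ℓ fun s =>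
          MumfordShah.curvature γ s * MumfordShah.normalVelocity T ε γ s) ∧
      Continuous (MumfordShah.δE f D η Ω γ) ∧
      MumfordShah.HasEulerianDerivative (MumfordShah.energy f D η) T Ω
        (MumfordShah.arcIntegral γ ℓ fun s =>
          MumfordShah.δE f D η Ω γ s * MumfordShah.normalVelocity T ε γ s) := by
  have hfγ := hΩ.continuous_comp hD (hT.subset hTD) hfΓ
  have hv := MumfordShah.continuous_normalVelocity hΩ hT
  have h1 := MumfordShah.hasEulerianDerivative_E₁ hD hDfin hΩ hf hfΓ hT hTD
  have h2 := MumfordShah.hasEulerianDerivative_E₂ hD hDfin hΩ hΩc hf hfΓ hT hTD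
  have h3 := MumfordShah.hasEulerianDerivative_E₃ hΩ hT
  have c1 := MumfordShah.continuous_δE₁ hfγ Ω
  have c2 : Continuous fun s => MumfordShah.δE₂ f D Ω (γ s) := by
    simp only [MumfordShah.δE₂_eq]
    exact (MumfordShah.continuous_δE₁ hfγ (D \ Ω)).neg
  have c3 := hΩ.continuous_curvature
  refine ⟨h1, h2, h3, (c1.add c2).add (continuous_const.mul c3), ?_⟩
  have heq : (MumfordShah.arcIntegral γ ℓ fun s =>
      MumfordShah.δE f D η Ω γ s * MumfordShah.normalVelocity T ε γ s) =
      MumfordShah.arcIntegral γ ℓ (fun s =>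
        MumfordShah.δE₁ f Ω (γ s) * MumfordShah.normalVelocity T ε γ s) +
      MumfordShah.arcIntegral γ ℓ (fun s =>
        MumfordShah.δE₂ f D Ω (γ s) * MumfordShah.normalVelocity T ε γ s) +
      η * MumfordShah.arcIntegral γ ℓ (fun s =>
        MumfordShah.curvature γ s * MumfordShah.normalVelocity T ε γ s) := by
    have m1 : Continuous fun s =>
        MumfordShah.δE₁ f Ω (γ s) * MumfordShah.normalVelocity T ε γ s := c1.mul hv
    have m2 : Continuous fun s =>
        MumfordShah.δE₂ f D Ω (γ s) * MumfordShah.normalVelocity T ε γ s := c2.mul hv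
    have m3 : Continuous fun s =>
        η * (MumfordShah.curvature γ s * MumfordShah.normalVelocity T ε γ s) :=
      continuous_const.mul (c3.mul hv)
    have m12 : Continuous fun s =>
        MumfordShah.δE₁ f Ω (γ s) * MumfordShah.normalVelocity T ε γ s +
          MumfordShah.δE₂ f D Ω (γ s) * MumfordShah.normalVelocity T ε γ s := m1.add m2
    rw [← MumfordShah.arcIntegral_const_mul, ← MumfordShah.arcIntegral_add hΩ m1 m2,
      ← MumfordShah.arcIntegral_add hΩ m12 m3]
    congr 1
    ext s
    simp only [MumfordShah.δE]
    ring
  rw [heq]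
  rw [hT.hasEulerianDerivative_iff] at h1 h2 h3 ⊢
  exact (h1.add h2).add (h3.const_mul η)
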